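/- Let $\mathbb{F}$ be an algebraically closed field and $G$ an abelian group. Algebras are $\mathbb{F}$-vector spaces with a bilinear multiplication (not necessarily associative, commutative or unital). An algebra is simple if $\mathcal{A}^2\neq 0$ and it has no ideals other than $0$ and $\mathcal{A}$; it is semisimple if it is a finite (possibly empty) direct sum of simple ideals; it is central simple if it is simple and its centroid (the centralizer in $\mathrm{End}_{\mathbb{F}}(\mathcal{A})$ of all left and right multiplications) is $\mathbb{F}1$. A $G$-graded algebra is an algebra $\mathcal{A}=\bigoplus_{g\in G}\mathcal{A}_g$ with $\mathcal{A}_g\mathcal{A}_h\subseteq\mathcal{A}_{gh}$; an isomorphism of $G$-graded algebras is an algebra isomorphism $\varphi$ with $\varphi(\mathcal{A}_g)=\mathcal{A}'_g$ for all $g$. It is graded-simple if $\mathcal{A}^2\neq0$ and it has no graded ideals other than $0$ and $\mathcal{A}$. The product $G$-grading on $\mathcal{B}^1\times\cdots\times\mathcal{B}^n$ is given by $(\mathcal{B}^1\times\cdots\times\mathcal{B}^n)_g=\mathcal{B}^1_g\times\cdots\times\mathcal{B}^n_g$. For a surjective homomorphism $\pi:G\to\overline{G}$ of abelian groups and a $\overline{G}$-graded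 algebra $\mathcal{A}$, the loop algebra is the $G$-graded algebra $L_\pi(\mathcal{A})=\bigoplus_{g\in G}\mathcal{A}_{\pi(g)}\otimes g\subseteq\mathcal{A}\otimes_{\mathbb{F}}\mathbb{F}G$, with $L_\pi(\mathcal{A})_g=\mathcal{A}_{\pi(g)}\otimes g$. (1) Every semisimple $G$-graded algebra $\mathcal{B}$ is isomorphic, as a $G$-graded algebra, to a product $\mathcal{B}^1\times\cdots\times\mathcal{B}^n$, with the product $G$-grading, of $G$-graded algebras $\mathcal{B}^i$ that are graded-simple and semisimple. The factors $\mathcal{B}^i$ are uniquely determined up to reordering and isomorphism of $G$-graded algebras. (2) Every finite-dimensional graded-simple $G$-graded algebra $\mathcal{B}$ is isomorphic, as a $G$-graded algebra, to the loop algebra $L_\pi(\mathcal{A})$ associated to a surjective group homomorphism $\pi:G\to\overline{G}$ with finite kernel $H$ and a central simple $\overline{G}$-graded algebra $\mathcal{A}$; the algebra $\mathcal{A}$ is a quotient of $\mathcal{B}$ (there is a surjective homomorphism of algebras $\mathcal{B}\to\mathcal{A}$). Moreover, for every such $\pi$ and $\mathcal{A}$, the algebra $\mathcal{A}$ is a quotient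 of $\mathcal{B}$, and $\mathcal{B}$ is semisimple if and only if $\mathrm{char}\,\mathbb{F}$ does not divide $|H|$. -/

import Mathlib

namespace AlgGrading

section Algebras

/-! Algebras are vector spaces with a bilinear multiplication, not necessarily associative,
commutative or unital. -/

variable (F : Type*) [Field F] (A : Type*) [NonUnitalNonAssocRing A] [Module F A]

variable {F A} in
/-- A subspace that is a two-sided ideal of the algebra `A`. -/
def IsIdeal (I : Submodule F A) : Prop :=
  ∀ a x : A, x ∈ I → a * x ∈ I ∧ x * a ∈ I

/-- `A` is simple: `A² ≠ 0` and the only ideals are `0` and `A`. -/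
def IsSimpleAlg : Prop :=
  (∃ x y : A, x * y ≠ 0) ∧ ∀ I : Submodule F A, IsIdeal I → I = ⊥ ∨ I = ⊤

/-- `A` is semisimple: it is the direct sum of finitely many ideals each of which is
a simple algebra. (The zero algebra is the empty direct sum.) -/
def IsSemisimpleAlg : Prop :=
  ∃ (n : ℕ) (J : Fin n → NonUnitalSubalgebra F A),
    (∀ i, IsIdeal (J i).toSubmodule) ∧ (∀ i, IsSimpleAlg F (J i)) ∧
      DirectSum.IsInternal fun i => (J i).toSubmodule

variable [SMulCommClass F A A] [IsScalarTower F A A]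

/-- The centroid of `A`: the centralizer in `End_F(A)` of the multiplication algebra, i.e. of the
subalgebra generated by all left and right multiplications. -/
def centroid : Subalgebra F (Module.End F A) :=
  Subalgebra.centralizer F
    (Algebra.adjoin F (Set.range (fun a : A => LinearMap.mulLeft F a) ∪
      Set.range (fun a : A => LinearMap.mulRight F a)) : Set (Module.End F A))

/-- `A` is central simple: it is simple and its centroid is `F · 1`. -/
def IsCentralSimpleAlg : Prop :=
  IsSimpleAlg F A ∧ centroid F A = ⊥

end Algebras

/-- A `G`-graded `F`-algebra: an algebra `A = ⨁_{g ∈ G} A_g` with `A_g A_h ⊆ A_{gh}`. -/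
structure GrAlg.{w, u, v} (F : Type u) [Field F] (G : Type v) [CommGroup G] :
    Type (max u v (w + 1)) where
  /-- the underlying set -/
  carrier : Type w
  [ring : NonUnitalNonAssocRing carrier]
  [module : Module F carrier]
  [smulCommClass : SMulCommClass F carrier carrier]
  [isScalarTower : IsScalarTower F carrier carrier]
  /-- the component of degree `g` -/
  comp : G → Submodule F carrier
  iSupIndep_comp : iSupIndep comp
  iSup_comp : ⨆ g, comp g = ⊤
  mul_mem : ∀ {g h : G} {x y : carrier}, x ∈ comp g → y ∈ comp h → x * y ∈ comp (g * h)

namespace GrAlg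

instance (F : Type*) [Field F] (G : Type*) [CommGroup G] : CoeSort (GrAlg F G) (Type _) :=
  ⟨GrAlg.carrier⟩

attribute [instance] ring module smulCommClass isScalarTower

variable {F : Type*} [Field F] {G : Type*} [CommGroup G]

/-- A graded ideal: an ideal `I` with `I = ⨁_g (I ∩ A_g)`. -/
def IsGradedIdeal (A : GrAlg F G) (I : Submodule F A) : Prop :=
  IsIdeal I ∧ I = ⨆ g, I ⊓ A.comp g

/-- `A` is graded-simple: `A² ≠ 0` and the only graded ideals are `0` and `A`. -/
def IsGradedSimple (A : GrAlg F G) : Prop :=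
  (∃ x y : A, x * y ≠ 0) ∧ ∀ I : Submodule F A, A.IsGradedIdeal I → I = ⊥ ∨ I = ⊤

/-- `A` and `B` are isomorphic as `G`-graded algebras: there is an isomorphism of algebras
`φ : A → B` with `φ(A_g) = B_g` for all `g`. -/
def Isomorphic (A B : GrAlg F G) : Prop :=
  ∃ φ : A →ₙₐ[F] B, Function.Bijective φ ∧
    ∀ g, (A.comp g).map (φ : A →ₗ[F] B) = B.comp g

/-- The product `G`-grading on `A¹ × ⋯ × Aⁿ`:
`(A¹ × ⋯ × Aⁿ)_g = A¹_g × ⋯ × Aⁿ_g`. -/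
def prod {n : ℕ} (A : Fin n → GrAlg F G) : GrAlg F G where
  carrier := ∀ i, A i
  comp g := Submodule.pi Set.univ fun i => (A i).comp g
  iSupIndep_comp := by
    rw [iSupIndep_iff_finsetSum_eq_zero_imp_eq_zero]
    intro s v hv h0 g hg
    funext i
    have h1 := (iSupIndep_iff_finsetSum_eq_zero_imp_eq_zero _).1 (A i).iSupIndep_comp s
      (fun g => v g i) (fun g hg => hv g hg i trivial)
      (by have := congrFun h0 i; simpa using this)
    exact h1 g hg
  iSup_comp := by
    rw [eq_top_iff]
    intro x _
    have hx : x = ∑ i, Pi.single i (x i) := (Finset.univ_sum_single x).symm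
    rw [hx]
    refine Submodule.sum_mem _ fun i _ => ?_
    have h1 : x i ∈ ⨆ g, (A i).comp g := by rw [(A i).iSup_comp]; trivial
    have h2 : (⨆ g, (A i).comp g) ≤
        (⨆ g, Submodule.pi Set.univ fun j => (A j).comp g).comap
          (LinearMap.single F (fun j => (A j : Type _)) i) := by
      refine iSup_le fun g y hy => ?_
      refine Submodule.mem_iSup_of_mem g ?_
      intro j _
      by_cases hj : j = i
      · subst hj; simpa using hy
      · simp [hj]
    exact h2 h1
  mul_mem hx hy i hi := (A i).mul_mem (hx i hi) (hy i hi)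

section Loop

variable {G' : Type*} [CommGroup G'] (π : G →* G') (A : GrAlg F G')

open scoped TensorProduct in
/-- The subspace `A_{π(g)} ⊗ g` of `A ⊗ F[G]`. -/
noncomputable def loopComp (g : G) : Submodule F (A ⊗[F] MonoidAlgebra F G) :=
  (A.comp (π g)).map
    ((TensorProduct.mk F A (MonoidAlgebra F G)).flip (MonoidAlgebra.single g 1))

theorem loopComp_mul {g h : G} {x y} (hx : x ∈ loopComp π A g) (hy : y ∈ loopComp π A h) :
    x * y ∈ loopComp π A (g * h) := by
  obtain ⟨a, ha, rfl⟩ := hx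
  obtain ⟨b, hb, rfl⟩ := hy
  refine ⟨a * b, by rw [map_mul]; exact A.mul_mem ha hb, ?_⟩
  simp [Algebra.TensorProduct.tmul_mul_tmul, MonoidAlgebra.single_mul_single]

theorem iSupIndep_loopComp : iSupIndep (loopComp π A) := by
  classical
  rw [iSupIndep_iff_finsetSum_eq_zero_imp_eq_zero]
  intro s v hv h0 g hg
  choose! a ha hva using hv
  let c := (TensorProduct.rid F A).toLinearMap ∘ₗ LinearMap.lTensor A
    (Finsupp.lapply g ∘ₗ (MonoidAlgebra.coeffLinearEquiv F :
      MonoidAlgebra F G ≃ₗ[F] (G →₀ F)).toLinearMap)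
  have hc : ∀ k ∈ s, c (v k) = if k = g then a k else 0 := by
    intro k hk
    rw [← hva k hk]
    simp [c, Finsupp.single_apply]
  have h1 : ∑ k ∈ s, c (v k) = 0 := by rw [← map_sum, h0, map_zero]
  rw [Finset.sum_congr rfl hc] at h1
  have h3 : a g = 0 := by simpa [hg] using h1
  rw [← hva g hg, h3, map_zero]

open scoped TensorProduct in
/-- The subalgebra `⨁_{g ∈ G} A_{π(g)} ⊗ g` of `A ⊗ F[G]`. -/
noncomputable def loopSubalgebra : NonUnitalSubalgebra F (A ⊗[F] MonoidAlgebra F G) where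
  toSubmodule := ⨆ g, loopComp π A g
  mul_mem' := by
    intro x y hx hy
    refine Submodule.iSup_induction (loopComp π A) (motive := fun x => x * y ∈ _) hx
      (fun g x hx => ?_) ?_ ?_
    · refine Submodule.iSup_induction (loopComp π A) (motive := fun y => x * y ∈ _) hy
        (fun h y hy => ?_) ?_ ?_
      · exact Submodule.mem_iSup_of_mem (g * h) (loopComp_mul π A hx hy)
      · rw [mul_zero]; exact zero_mem (⨆ g, loopComp π A g)
      · intro y z h1 h2; rw [mul_add]; exact add_mem (S := Submodule F _) h1 h2
    · rw [zero_mul]; exact zero_mem (⨆ g, loopComp π A g)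
    · intro y z h1 h2; rw [add_mul]; exact add_mem (S := Submodule F _) h1 h2

theorem iSupIndep_comap_subtype {ι M : Type*} [AddCommGroup M] [Module F M] (L : Submodule F M)
    {N : ι → Submodule F M} (hN : iSupIndep N) :
    iSupIndep fun i => (N i).comap L.subtype := by
  rw [iSupIndep_iff_finsetSum_eq_zero_imp_eq_zero] at hN ⊢
  intro s v hv h0 i hi
  refine Subtype.ext (hN s (fun i => (v i).1) hv ?_ i hi)
  simpa using congrArg L.subtype h0

/-- The loop algebra `L_π(A) = ⨁_{g ∈ G} A_{π(g)} ⊗ g`, with `L_π(A)_g = A_{π(g)} ⊗ g`. -/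
noncomputable def loop : GrAlg F G where
  carrier := loopSubalgebra π A
  comp g := (loopComp π A g).comap (loopSubalgebra π A).toSubmodule.subtype
  iSupIndep_comp := iSupIndep_comap_subtype _ (iSupIndep_loopComp π A)
  iSup_comp := by
    refine Submodule.map_injective_of_injective
      (loopSubalgebra π A).toSubmodule.injective_subtype ?_
    rw [Submodule.map_iSup, Submodule.map_top, Submodule.range_subtype]
    refine iSup_congr fun g => ?_
    rw [Submodule.map_comap_subtype, inf_eq_right]
    exact le_iSup (loopComp π A) g
  mul_mem hx hy := loopComp_mul π A hx hy

end Loop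

end GrAlg

end AlgGrading

open AlgGrading

universe u v w v₁ w₁

namespace AlgGrading

/-! Part (1) rests on ideals. In a direct sum of simple ideals every ideal is a sum of some of the
summands (`SimpleDecomp.ideal_eq`), hence is complemented by its annihilator, and the annihilator of
a graded ideal is graded. So the smallest graded ideal containing a given simple summand is minimal,
and the distinct ideals obtained in this way are the factors. For uniqueness, an isomorphism of
products is a matrix of graded homomorphisms, each zero or bijective by Schur's lemma, with exactly
one bijective entry in each row and column.

For part (2), an isomorphism of `B` with the loop algebra amounts to a homomorphism `q : B → A`
restricting to bijections from `B_g` to `A_{π(g)}` (`IsLoopMap`). To find one, note that nonzero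
homogeneous elements of the centroid of a graded-simple `B` are invertible. Their degrees form a
finite subgroup `H`, and a character of the commutative, finite-dimensional centroid selects
elements `c_h` with `c_h c_k = c_{hk}`. Then `A` is the quotient of `B` by the kernel of the trace
`∑ c_h`, graded by `G ⧸ H`. It is simple: an element of minimal support in a nonzero ideal, if not
homogeneous, would produce a centroid element of `B` of degree outside `H`.

For semisimplicity, given any such `q`, the kernel `H` of `π` acts on `B` through the centroid, and
`E_χ = ∑ χ(h)⁻¹ c_h` satisfies `E_χ² = |H| E_χ`. If `|H|` is invertible in `F`, then `B` is the
direct sum of the images of the `E_χ`, each an ideal isomorphic to `A`. If `|H| = 0` in `F`, the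
image of `E_1` is a nonzero ideal with zero product. -/

/-- A linear endomorphism that commutes with all left and right multiplications. -/
def IsCentroidal {F A : Type*} [Field F] [NonUnitalNonAssocRing A] [Module F A]
    (c : A →ₗ[F] A) : Prop :=
  ∀ x y : A, c (x * y) = c x * y ∧ c (x * y) = x * c y

/-! ### Ideals and independent families of subspaces -/

section Ideals

variable {F A : Type*} [Field F] [NonUnitalNonAssocRing A] [Module F A]

theorem isIdeal_ker_of_isCentroidal {c : A →ₗ[F] A} (hc : IsCentroidal c) :
    IsIdeal (LinearMap.ker c) := by
  intro a x hx
  rw [LinearMap.mem_ker] at hx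
  simp [(hc a x).2, (hc x a).1, hx]

theorem isIdeal_range_of_isCentroidal {c : A →ₗ[F] A} (hc : IsCentroidal c) :
    IsIdeal (LinearMap.range c) := by
  rintro a _ ⟨x, rfl⟩
  exact ⟨⟨a * x, (hc a x).2⟩, ⟨x * a, (hc x a).1⟩⟩

theorem IsIdeal.inf {I J : Submodule F A} (hI : IsIdeal I) (hJ : IsIdeal J) : IsIdeal (I ⊓ J) :=
  fun a x hx => ⟨⟨(hI a x hx.1).1, (hJ a x hx.2).1⟩, ⟨(hI a x hx.1).2, (hJ a x hx.2).2⟩⟩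

theorem IsIdeal.iSup {ι : Sort*} {I : ι → Submodule F A} (hI : ∀ i, IsIdeal (I i)) :
    IsIdeal (⨆ i, I i) := by
  intro a x hx
  refine Submodule.iSup_induction I (motive := fun x => a * x ∈ _ ∧ x * a ∈ _) hx
    (fun i x hx => ?_) ?_ ?_
  · exact ⟨Submodule.mem_iSup_of_mem i (hI i a x hx).1, Submodule.mem_iSup_of_mem i (hI i a x hx).2⟩
  · simp
  · intro y z hy hz
    rw [mul_add, add_mul]
    exact ⟨add_mem hy.1 hz.1, add_mem hy.2 hz.2⟩

/-- An ideal, as a subalgebra. -/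
def IsIdeal.toSubalgebra {I : Submodule F A} (hI : IsIdeal I) : NonUnitalSubalgebra F A where
  toSubmodule := I
  mul_mem' := fun {x y} _ hy => (hI x y hy).1

theorem iSupIndep_of_projections {ι M : Type*} [AddCommGroup M] [Module F M]
    {N : ι → Submodule F M} (Q : ι → M →ₗ[F] M) (h1 : ∀ i, ∀ x ∈ N i, Q i x = x)
    (h2 : ∀ i j, j ≠ i → ∀ x ∈ N j, Q i x = 0) : iSupIndep N := by
  classical
  rw [iSupIndep_iff_finsetSum_eq_zero_imp_eq_zero]
  intro s v hv h0 i hi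
  have h3 := congrArg (Q i) h0
  rw [map_sum, map_zero, Finset.sum_eq_single_of_mem i hi
    (fun j hj hji => h2 i j hji _ (hv j hj)), h1 i _ (hv i hi)] at h3
  exact h3

/-- By the modular law `P i` is `N i` plus its intersection with the sum of the other `N j`, and
that intersection vanishes by independence. This is why a bijective homomorphism only has to map
components into components. -/
theorem iSupIndep_eq_of_le {ι M : Type*} [AddCommGroup M] [Module F M]
    {N P : ι → Submodule F M} (hP : iSupIndep P) (hle : ∀ i, N i ≤ P i)
    (htop : ⨆ i, N i = ⊤) (i : ι) : N i = P i := by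
  refine le_antisymm (hle i) ?_
  have h1 : N i ⊔ ⨆ (j) (_ : j ≠ i), N j = ⊤ := by
    rw [eq_top_iff, ← htop]
    refine iSup_le fun j => ?_
    by_cases h : j = i
    · subst h; exact le_sup_left
    · exact le_sup_of_le_right (le_iSup₂_of_le j h le_rfl)
  have h2 : P i ⊓ ⨆ (j) (_ : j ≠ i), N j = ⊥ :=
    ((hP i).mono_right (iSup₂_mono fun j _ => hle j)).eq_bot
  calc P i = (N i ⊔ ⨆ (j) (_ : j ≠ i), N j) ⊓ P i := by rw [h1, top_inf_eq]
    _ = N i ⊔ (⨆ (j) (_ : j ≠ i), N j) ⊓ P i := (sup_inf_assoc_of_le _ (hle i))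
    _ = N i := by rw [inf_comm, h2, sup_bot_eq]
    _ ≤ N i := le_rfl

end Ideals

/-! ### Homogeneous components, projections, isomorphisms -/

namespace GrAlg

variable {F : Type*} [Field F] {G : Type*} [CommGroup G] (B : GrAlg F G)

open scoped Classical in
theorem isInternal : DirectSum.IsInternal B.comp :=
  (DirectSum.isInternal_submodule_iff_iSupIndep_and_iSup_eq_top _).2
    ⟨B.iSupIndep_comp, B.iSup_comp⟩

section Lift

variable {M : Type*} [AddCommGroup M] [Module F M]

open scoped Classical in
/-- The linear map with prescribed restrictions to the homogeneous components. -/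
noncomputable def lift (f : ∀ g, B.comp g →ₗ[F] M) : B →ₗ[F] M :=
  DirectSum.toModule F G M f ∘ₗ
    (LinearEquiv.ofBijective (DirectSum.coeLinearMap B.comp) B.isInternal).symm.toLinearMap

theorem lift_of_mem (f : ∀ g, B.comp g →ₗ[F] M) {g : G} {x : B} (hx : x ∈ B.comp g) :
    B.lift f x = f g ⟨x, hx⟩ := by
  classical
  have : (LinearEquiv.ofBijective (DirectSum.coeLinearMap B.comp) B.isInternal).symm x =
      DirectSum.of (fun g => B.comp g) g ⟨x, hx⟩ := by
    rw [LinearEquiv.symm_apply_eq]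
    exact (DirectSum.coeLinearMap_of B.comp g ⟨x, hx⟩).symm
  simp only [lift, LinearMap.comp_apply, LinearEquiv.coe_coe, this]
  exact DirectSum.toModule_lof F g _

variable {B} in
theorem hom_induction {p : B → Prop} (h : ∀ g, ∀ x ∈ B.comp g, p x) (h0 : p 0)
    (hadd : ∀ x y, p x → p y → p (x + y)) (x : B) : p x := by
  have hx : x ∈ ⨆ g, B.comp g := by rw [B.iSup_comp]; trivial
  exact Submodule.iSup_induction B.comp (motive := p) hx h h0 hadd

variable {B} in
theorem linearMap_ext {f f' : B →ₗ[F] M} (h : ∀ g, ∀ x ∈ B.comp g, f x = f' x) : f = f' := by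
  ext x
  refine hom_induction (p := fun x => f x = f' x) h (by simp) ?_ x
  intro x y hx hy
  simp [hx, hy]

end Lift

open scoped Classical in
/-- The projection to the component of degree `g`. -/
noncomputable def proj (g : G) : B →ₗ[F] B :=
  B.lift fun k => if k = g then (B.comp k).subtype else 0

variable {B}

theorem proj_of_mem {g : G} {x : B} (hx : x ∈ B.comp g) : B.proj g x = x := by
  simp [proj, B.lift_of_mem _ hx]

theorem proj_of_mem_ne {g k : G} {x : B} (hx : x ∈ B.comp k) (h : k ≠ g) : B.proj g x = 0 := by
  simp [proj, B.lift_of_mem _ hx, h]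

theorem proj_mem (g : G) (x : B) : B.proj g x ∈ B.comp g := by
  refine hom_induction (p := fun x => B.proj g x ∈ B.comp g) ?_ (by simp) ?_ x
  · intro k x hx
    by_cases h : k = g
    · subst h; rwa [proj_of_mem hx]
    · simp [proj_of_mem_ne hx h]
  · intro x y hx hy
    rw [map_add]
    exact add_mem hx hy

theorem exists_eq_sum_proj (x : B) : ∃ s : Finset G,
    x = ∑ g ∈ s, B.proj g x ∧ ∀ g, g ∉ s → B.proj g x = 0 := by
  classical
  refine hom_induction (p := fun x => ∃ s : Finset G,
    x = ∑ g ∈ s, B.proj g x ∧ ∀ g, g ∉ s → B.proj g x = 0) ?_ ⟨∅, by simp⟩ ?_ x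
  · intro k x hx
    refine ⟨{k}, by simp [proj_of_mem hx], fun g hg => proj_of_mem_ne hx ?_⟩
    rintro rfl
    simp at hg
  · rintro x y ⟨s, hs, hs'⟩ ⟨t, ht, ht'⟩
    refine ⟨s ∪ t, ?_, ?_⟩
    · simp only [map_add, Finset.sum_add_distrib]
      rw [← Finset.sum_subset (Finset.subset_union_left (s₁ := s) (s₂ := t)) fun g _ h => hs' g h,
        ← Finset.sum_subset (Finset.subset_union_right (s₁ := s) (s₂ := t)) fun g _ h => ht' g h,
        ← hs, ← ht]
    · intro g hg
      simp only [Finset.mem_union, not_or] at hg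
      simp [hs' g hg.1, ht' g hg.2]

theorem eq_zero_of_proj {x : B} (h : ∀ g, B.proj g x = 0) : x = 0 := by
  obtain ⟨s, hs, -⟩ := B.exists_eq_sum_proj x
  rw [hs]
  exact Finset.sum_eq_zero fun g _ => h g

theorem mem_of_proj_mem {I : Submodule F B} {x : B} (h : ∀ g, B.proj g x ∈ I) : x ∈ I := by
  obtain ⟨s, hs, -⟩ := B.exists_eq_sum_proj x
  rw [hs]
  exact Submodule.sum_mem _ fun g _ => h g

/-- The degree of a homogeneous map shifts projections. -/
theorem proj_comm {G' : Type*} [CommGroup G'] {C : GrAlg F G'} (f : B →ₗ[F] C) (τ : G → G')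
    (hτ : Function.Injective τ) (hf : ∀ g, ∀ x ∈ B.comp g, f x ∈ C.comp (τ g)) (g : G) (x : B) :
    C.proj (τ g) (f x) = f (B.proj g x) := by
  refine hom_induction (p := fun x => C.proj (τ g) (f x) = f (B.proj g x)) ?_ (by simp) ?_ x
  · intro k x hx
    by_cases h : k = g
    · subst h
      rw [proj_of_mem hx, proj_of_mem (hf k x hx)]
    · rw [proj_of_mem_ne hx h, proj_of_mem_ne (hf k x hx) (fun e => h (hτ e)), map_zero]
  · intro x y hx hy
    simp only [map_add, hx, hy]

theorem proj_mul_left {h : G} {a : B} (ha : a ∈ B.comp h) (g : G) (x : B) :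
    B.proj (h * g) (a * x) = a * B.proj g x :=
  proj_comm (LinearMap.mulLeft F a) (fun g => h * g) (mul_right_injective h)
    (fun _ _ hx => B.mul_mem ha hx) g x

theorem proj_mul_right {h : G} {a : B} (ha : a ∈ B.comp h) (g : G) (x : B) :
    B.proj (h * g) (x * a) = B.proj g x * a :=
  proj_comm (LinearMap.mulRight F a) (fun g => h * g) (mul_right_injective h)
    (fun g x hx => by rw [mul_comm]; exact B.mul_mem hx ha) g x

theorem isGradedIdeal_iff {I : Submodule F B} :
    B.IsGradedIdeal I ↔ IsIdeal I ∧ ∀ x ∈ I, ∀ g, B.proj g x ∈ I := by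
  refine and_congr_right fun _ => ⟨fun h x hx g => ?_, fun h => le_antisymm ?_ ?_⟩
  · rw [h] at hx
    refine Submodule.iSup_induction (fun g => I ⊓ B.comp g)
      (motive := fun x => B.proj g x ∈ I) hx (fun k x hx => ?_) (by simp) ?_
    · by_cases hk : k = g
      · subst hk; rw [proj_of_mem hx.2]; exact hx.1
      · rw [proj_of_mem_ne hx.2 hk]; exact zero_mem _
    · intro x y hx hy
      rw [map_add]; exact add_mem hx hy
  · intro x hx
    exact mem_of_proj_mem fun g => Submodule.mem_iSup_of_mem g ⟨h x hx g, proj_mem g x⟩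
  · exact iSup_le fun g => inf_le_left

theorem isIdeal_of_homogeneous {I : Submodule F B}
    (h : ∀ g k, ∀ a ∈ B.comp g, ∀ x ∈ I ⊓ B.comp k, a * x ∈ I ∧ x * a ∈ I)
    (hI : ∀ x ∈ I, ∀ g, B.proj g x ∈ I) : IsIdeal I := by
  intro a x hx
  refine hom_induction (p := fun a => a * x ∈ I ∧ x * a ∈ I) (fun g a ha => ?_) (by simp) ?_ a
  · obtain ⟨s, hs, -⟩ := B.exists_eq_sum_proj x
    rw [hs, Finset.mul_sum, Finset.sum_mul]
    exact ⟨Submodule.sum_mem _ fun k _ => (h g k a ha _ ⟨hI x hx k, proj_mem k x⟩).1,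
      Submodule.sum_mem _ fun k _ => (h g k a ha _ ⟨hI x hx k, proj_mem k x⟩).2⟩
  · intro a b ha hb
    rw [add_mul, mul_add]
    exact ⟨add_mem ha.1 hb.1, add_mem ha.2 hb.2⟩

theorem isCentroidal_of_homogeneous {c : B →ₗ[F] B}
    (h : ∀ g k, ∀ x ∈ B.comp g, ∀ y ∈ B.comp k, c (x * y) = c x * y ∧ c (x * y) = x * c y) :
    IsCentroidal c := by
  intro x y
  refine hom_induction (p := fun x => c (x * y) = c x * y ∧ c (x * y) = x * c y)
    (fun g x hx => ?_) (by simp) ?_ x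
  · refine hom_induction (p := fun y => c (x * y) = c x * y ∧ c (x * y) = x * c y)
      (fun k y hy => h g k x hx y hy) (by simp) ?_ y
    intro y z hy hz
    simp only [mul_add, map_add]
    exact ⟨by rw [hy.1, hz.1], by rw [hy.2, hz.2]⟩
  · intro y z hy hz
    simp only [add_mul, map_add]
    exact ⟨by rw [hy.1, hz.1], by rw [hy.2, hz.2]⟩

theorem map_mul_of_homogeneous {C : Type*} [NonUnitalNonAssocRing C] [Module F C] {f : B →ₗ[F] C}
    (h : ∀ g k, ∀ x ∈ B.comp g, ∀ y ∈ B.comp k, f (x * y) = f x * f y) (x y : B) :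
    f (x * y) = f x * f y := by
  refine hom_induction (p := fun x => f (x * y) = f x * f y) (fun g x hx => ?_) (by simp) ?_ x
  · refine hom_induction (p := fun y => f (x * y) = f x * f y)
      (fun k y hy => h g k x hx y hy) (by simp) ?_ y
    intro y z hy hz
    simp only [mul_add, map_add, hy, hz]
  · intro y z hy hz
    simp only [add_mul, map_add, hy, hz]

/-- A bijective homomorphism that preserves degrees is an isomorphism of graded algebras. -/
theorem isomorphic_of_bijective {C : GrAlg F G} (φ : B →ₙₐ[F] C) (hφ : Function.Bijective φ)
    (h : ∀ g, ∀ x ∈ B.comp g, φ x ∈ C.comp g) : B.Isomorphic C := by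
  refine ⟨φ, hφ, iSupIndep_eq_of_le C.iSupIndep_comp (fun g => ?_) ?_⟩
  · rintro _ ⟨x, hx, rfl⟩
    exact h g x hx
  · rw [← Submodule.map_iSup, B.iSup_comp, Submodule.map_top, LinearMap.range_eq_top]
    exact hφ.2

theorem Isomorphic.symm {C : GrAlg F G} (h : B.Isomorphic C) : C.Isomorphic B := by
  obtain ⟨φ, hφ, h⟩ := h
  let e := LinearEquiv.ofBijective (φ : B →ₗ[F] C) hφ
  have he : ∀ x, φ (e.symm x) = x := fun x => e.apply_symm_apply x
  let ψ : C →ₙₐ[F] B :=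
    { toFun := e.symm
      map_smul' := fun c x => map_smul e.symm c x
      map_zero' := map_zero e.symm
      map_add' := map_add e.symm
      map_mul' := fun x y => hφ.1 (by rw [he, map_mul, he, he]) }
  refine isomorphic_of_bijective ψ e.symm.bijective fun g x hx => ?_
  rw [← h g] at hx
  obtain ⟨y, hy, rfl⟩ := hx
  have : ψ (φ y) = y := e.symm_apply_apply y
  exact this.symm ▸ hy

theorem Isomorphic.trans {C D : GrAlg F G} (h : B.Isomorphic C) (h' : C.Isomorphic D) :
    B.Isomorphic D := by
  obtain ⟨φ, hφ, h⟩ := h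
  obtain ⟨ψ, hψ, h'⟩ := h'
  refine isomorphic_of_bijective (ψ.comp φ) (hψ.comp hφ) fun g x hx => ?_
  rw [← h' g, ← h g]
  exact ⟨φ x, ⟨x, hx, rfl⟩, rfl⟩

end GrAlg

/-! ### Schur's lemma and uniqueness of graded-simple factors -/

namespace GrAlg

variable {F : Type*} [Field F] {G : Type*} [CommGroup G]

/-- Schur's lemma for homomorphisms onto ideals. -/
theorem IsGradedSimple.eq_zero_or_bijective {C D : GrAlg F G} (hC : C.IsGradedSimple)
    (hD : D.IsGradedSimple) (f : C →ₙₐ[F] D) (hf : ∀ g, ∀ x ∈ C.comp g, f x ∈ D.comp g)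
    (hI : ∀ (d : D) (x : C), (∃ y, f y = d * f x) ∧ ∃ y, f y = f x * d) :
    (∀ x, f x = 0) ∨ Function.Bijective f := by
  have hp : ∀ g x, D.proj g (f x) = f (C.proj g x) :=
    proj_comm (f : C →ₗ[F] D) (fun g => g) Function.injective_id hf
  have hk : C.IsGradedIdeal (LinearMap.ker (f : C →ₗ[F] D)) := by
    refine isGradedIdeal_iff.2 ⟨fun a x hx => ?_, fun x hx g => ?_⟩
    · have hx : f x = 0 := hx
      constructor
      · change f (a * x) = 0
        rw [map_mul, hx, mul_zero]
      · change f (x * a) = 0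
        rw [map_mul, hx, zero_mul]
    · have hx : f x = 0 := hx
      change f (C.proj g x) = 0
      rw [← hp, hx, map_zero]
  have hr : D.IsGradedIdeal (LinearMap.range (f : C →ₗ[F] D)) := by
    refine isGradedIdeal_iff.2 ⟨?_, ?_⟩
    · rintro d _ ⟨x, rfl⟩
      exact hI d x
    · rintro _ ⟨x, rfl⟩ g
      exact ⟨C.proj g x, (hp g x).symm⟩
  rcases hC.2 _ hk with h | h
  · rcases hD.2 _ hr with h' | h'
    · left
      intro x
      have : f x ∈ LinearMap.range (f : C →ₗ[F] D) := ⟨x, rfl⟩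
      rw [h'] at this
      exact this
    · right
      exact ⟨LinearMap.ker_eq_bot.1 h, LinearMap.range_eq_top.1 h'⟩
  · left
    intro x
    have : x ∈ LinearMap.ker (f : C →ₗ[F] D) := by rw [h]; trivial
    exact this

/-- View `ψ` as a matrix with entries `f i j`. The image of each factor is an ideal of the target,
so the image of each entry is an ideal of `D j` and Schur's lemma applies; it remains to see that
the bijective entries form a permutation matrix. -/
theorem exists_equiv_of_prod_bijective {n m : ℕ} {C : Fin n → GrAlg F G} {D : Fin m → GrAlg F G}
    (hC : ∀ i, (C i).IsGradedSimple) (hD : ∀ j, (D j).IsGradedSimple)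
    (ψ : (∀ i, C i) →ₙₐ[F] (∀ j, D j)) (hψ : Function.Bijective ψ)
    (hdeg : ∀ g, ∀ x : ∀ i, C i, (∀ i, x i ∈ (C i).comp g) → ∀ j, ψ x j ∈ (D j).comp g) :
    ∃ σ : Fin n ≃ Fin m, ∀ i, (C i).Isomorphic (D (σ i)) := by
  let f : ∀ i j, C i →ₙₐ[F] D j := fun i j =>
    { toFun := fun x => ψ (Pi.single i x) j
      map_smul' := fun c x => by
        have h : (Pi.single i (c • x) : ∀ i, C i) = c • (Pi.single i x : ∀ i, C i) := by
          funext k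
          by_cases hk : k = i
          · subst hk; simp
          · simp [hk]
        rw [h, map_smul]; rfl
      map_zero' := by rw [Pi.single_zero, map_zero]; rfl
      map_add' := fun x y => by rw [Pi.single_add, map_add]; rfl
      map_mul' := fun x y => by rw [Pi.single_mul, map_mul]; rfl }
  have hfdef : ∀ i j x, f i j x = ψ (Pi.single i x) j := fun _ _ _ => rfl
  have hf : ∀ i j g, ∀ x ∈ (C i).comp g, f i j x ∈ (D j).comp g := by
    intro i j g x hx
    refine hdeg g _ (fun k => ?_) j
    by_cases h : k = i
    · subst h; simpa using hx
    · simp [h]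
  have hsingle : ∀ i (x : C i) (c : ∀ i, C i), c * Pi.single i x = Pi.single i (c i * x) ∧
      Pi.single i x * c = Pi.single i (x * c i) := by
    intro i x c
    constructor
    · funext k
      by_cases h : k = i
      · subst h; simp
      · simp [h]
    · funext k
      by_cases h : k = i
      · subst h; simp
      · simp [h]
  have hI : ∀ i (d : ∀ j, D j) (x : C i), (∃ y, ψ (Pi.single i y) = d * ψ (Pi.single i x)) ∧
      ∃ y, ψ (Pi.single i y) = ψ (Pi.single i x) * d := by
    intro i d x
    obtain ⟨c, rfl⟩ := hψ.2 d
    exact ⟨⟨c i * x, by rw [← map_mul, (hsingle i x c).1]⟩,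
      ⟨x * c i, by rw [← map_mul, (hsingle i x c).2]⟩⟩
  have hdich : ∀ i j, (∀ x, f i j x = 0) ∨ Function.Bijective (f i j) := by
    intro i j
    refine (hC i).eq_zero_or_bijective (hD j) (f i j) (hf i j) fun d x => ?_
    obtain ⟨⟨y, hy⟩, ⟨z, hz⟩⟩ := hI i (Pi.single j d) x
    refine ⟨⟨y, ?_⟩, ⟨z, ?_⟩⟩
    · rw [hfdef, hy]; simp [hfdef]
    · rw [hfdef, hz]; simp [hfdef]
  have hex : ∀ i, ∃ j, Function.Bijective (f i j) := by
    intro i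
    by_contra! h
    have h0 : ∀ j x, f i j x = 0 := fun j => (hdich i j).resolve_right (h j)
    obtain ⟨x, y, hxy⟩ := (hC i).1
    apply hxy
    have h1 : Pi.single i (x * y) = (0 : ∀ i, C i) := by
      apply hψ.1
      rw [map_zero]
      funext j
      exact h0 j _
    simpa using congrFun h1 i
  -- The product of an element supported at `j` with `ψ (Pi.single i y)` is `ψ (Pi.single i z)` for
  -- some `z`. Its coordinate at `j'` vanishes, so `z = 0`; its coordinate at `j` is the image of `x
  -- * y`.
  have huniq : ∀ i j j', Function.Bijective (f i j) → Function.Bijective (f i j') → j = j' := by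
    intro i j j' h h'
    by_contra hjj
    obtain ⟨x, y, hxy⟩ := (hC i).1
    obtain ⟨⟨z, hz⟩, -⟩ := hI i (Pi.single j (f i j x)) y
    have h1 : f i j' z = 0 := by
      rw [hfdef, hz]
      simp [Ne.symm hjj]
    have h2 : z = 0 := h'.1 (by rw [h1, map_zero])
    have h3 : f i j (x * y) = f i j z := by
      rw [hfdef i j z, hz, map_mul]
      simp [hfdef]
    rw [h2, map_zero] at h3
    exact hxy (h.1 (by rw [h3, map_zero]))
  -- Distinct factors of the source multiply to zero, so two bijective entries in one column would
  -- make the product of `D j` zero.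
  have hinj : ∀ i i' j, Function.Bijective (f i j) → Function.Bijective (f i' j) → i = i' := by
    intro i i' j h h'
    by_contra hii
    obtain ⟨x, y, hxy⟩ := (hD j).1
    obtain ⟨a, rfl⟩ := h.2 x
    obtain ⟨b, rfl⟩ := h'.2 y
    apply hxy
    have : (Pi.single i a : ∀ i, C i) * Pi.single i' b = 0 := by
      rw [(hsingle i' b _).1]
      simp [Ne.symm hii]
    have h2 := congrFun (congrArg ψ this) j
    rw [map_mul, map_zero] at h2
    exact h2
  have hsurj : ∀ j, ∃ i, Function.Bijective (f i j) := by
    intro j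
    by_contra! h
    have h0 : ∀ i x, f i j x = 0 := fun i => (hdich i j).resolve_right (h i)
    obtain ⟨x, y, hxy⟩ := (hD j).1
    apply hxy
    obtain ⟨c, hc⟩ := hψ.2 (Pi.single j x)
    have h1 : x = ψ c j := by rw [hc]; simp
    have h2 : ψ c j = 0 := by
      rw [← Finset.univ_sum_single c, map_sum, Finset.sum_apply]
      exact Finset.sum_eq_zero fun i _ => h0 i _
    rw [h1, h2, zero_mul]
  choose σ hσ using hex
  refine ⟨Equiv.ofBijective σ ⟨fun i i' h => ?_, fun j => ?_⟩, fun i => ?_⟩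
  · exact hinj i i' (σ i) (hσ i) (h ▸ hσ i')
  · obtain ⟨i, hi⟩ := hsurj j
    exact ⟨i, huniq i _ _ (hσ i) hi⟩
  · exact isomorphic_of_bijective (f i (σ i)) (hσ i) (hf i (σ i))

/-- Decompositions into graded-simple factors are unique. -/
theorem Isomorphic.exists_equiv_of_prod {n m : ℕ} {C : Fin n → GrAlg F G}
    {D : Fin m → GrAlg F G} (hC : ∀ i, (C i).IsGradedSimple) (hD : ∀ j, (D j).IsGradedSimple)
    (h : (prod C).Isomorphic (prod D)) :
    ∃ σ : Fin n ≃ Fin m, ∀ i, (C i).Isomorphic (D (σ i)) := by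
  obtain ⟨ψ, hψ, hg⟩ := h
  refine exists_equiv_of_prod_bijective hC hD ψ hψ fun g x hx j => ?_
  have h1 : ψ x ∈ (prod D).comp g := by
    rw [← hg g]
    exact ⟨x, fun i _ => hx i, rfl⟩
  exact h1 j trivial

end GrAlg

/-! ### Ideals and annihilators in semisimple algebras -/

section Semisimple

variable {F A : Type*} [Field F] [NonUnitalNonAssocRing A] [Module F A]

/-- The elements killed by all multiplications form an ideal, which is not everything because the
product is nonzero. -/
theorem IsSimpleAlg.exists_mul_ne_zero (h : IsSimpleAlg F A) [SMulCommClass F A A]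
    [IsScalarTower F A A] {x : A} (hx : x ≠ 0) : ∃ y, y * x ≠ 0 ∨ x * y ≠ 0 := by
  by_contra! h0
  let I : Submodule F A :=
    { carrier := {x | ∀ y, y * x = 0 ∧ x * y = 0}
      add_mem' := fun {a b} ha hb y => by simp [mul_add, add_mul, ha y, hb y]
      zero_mem' := fun y => by simp
      smul_mem' := fun c a ha y => by simp [mul_smul_comm, smul_mul_assoc, ha y] }
  have hI : IsIdeal I := fun a x hx => by
    rw [(hx a).1, (hx a).2]
    exact ⟨zero_mem I, zero_mem I⟩
  rcases h.2 I hI with h1 | h1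
  · have : x ∈ I := h0
    rw [h1] at this
    exact hx this
  · obtain ⟨a, b, hab⟩ := h.1
    have : b ∈ I := by rw [h1]; trivial
    exact hab (this a).1

/-- A family of ideals that exhibits `A` as a direct sum of simple algebras. -/
structure SimpleDecomp {ι : Type*} (J : ι → NonUnitalSubalgebra F A) : Prop where
  isIdeal : ∀ i, IsIdeal (J i).toSubmodule
  isSimple : ∀ i, IsSimpleAlg F (J i)
  indep : iSupIndep fun i => (J i).toSubmodule
  iSup_eq_top : ⨆ i, (J i).toSubmodule = ⊤

theorem isSemisimpleAlg_iff : IsSemisimpleAlg F A ↔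
    ∃ (n : ℕ) (J : Fin n → NonUnitalSubalgebra F A), SimpleDecomp J := by
  constructor
  · rintro ⟨n, J, h1, h2, h3⟩
    rw [DirectSum.isInternal_submodule_iff_iSupIndep_and_iSup_eq_top] at h3
    exact ⟨n, J, h1, h2, h3.1, h3.2⟩
  · rintro ⟨n, J, h1, h2, h3, h4⟩
    exact ⟨n, J, h1, h2, (DirectSum.isInternal_submodule_iff_iSupIndep_and_iSup_eq_top _).2 ⟨h3, h4⟩⟩

theorem SimpleDecomp.isSemisimpleAlg {ι : Type*} [Finite ι] {J : ι → NonUnitalSubalgebra F A}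
    (h : SimpleDecomp J) : IsSemisimpleAlg F A := by
  obtain ⟨n, ⟨e⟩⟩ := Finite.exists_equiv_fin ι
  refine isSemisimpleAlg_iff.2 ⟨n, J ∘ e.symm, fun i => h.isIdeal _, fun i => h.isSimple _,
    h.indep.comp e.symm.injective, ?_⟩
  rw [← h.iSup_eq_top]
  exact e.symm.iSup_comp (g := fun i => (J i).toSubmodule)

variable {ι : Type*} {J : ι → NonUnitalSubalgebra F A}

theorem SimpleDecomp.mul_eq_zero (h : SimpleDecomp J) {i j : ι} (hij : i ≠ j) {x y : A}
    (hx : x ∈ J i) (hy : y ∈ J j) : x * y = 0 := by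
  have : x * y ∈ (J i).toSubmodule ⊓ (J j).toSubmodule :=
    ⟨(h.isIdeal i y x hx).2, (h.isIdeal j x y hy).1⟩
  rw [(h.indep.pairwiseDisjoint hij).eq_bot] at this
  exact this

theorem SimpleDecomp.le_or_disjoint (h : SimpleDecomp J) {I : Submodule F A} (hI : IsIdeal I)
    (i : ι) : (J i).toSubmodule ≤ I ∨ (J i).toSubmodule ⊓ I = ⊥ := by
  have h1 : IsIdeal (A := J i) (I.comap (J i).toSubmodule.subtype) := fun a x hx =>
    hI a.1 x.1 hx
  rcases (h.isSimple i).2 _ h1 with h2 | h2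
  · right
    rw [eq_bot_iff]
    intro x hx
    have : (⟨x, hx.1⟩ : J i) ∈ I.comap (J i).toSubmodule.subtype := hx.2
    rw [h2] at this
    exact congrArg Subtype.val this
  · left
    intro x hx
    have : (⟨x, hx⟩ : J i) ∈ I.comap (J i).toSubmodule.subtype := by rw [h2]; trivial
    exact this

theorem SimpleDecomp.exists_sum (h : SimpleDecomp J) (x : A) : ∃ (s : Finset ι) (f : ι → A),
    (∀ i, f i ∈ J i) ∧ x = ∑ i ∈ s, f i := by
  have hx : x ∈ ⨆ i, (J i).toSubmodule := by rw [h.iSup_eq_top]; trivial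
  obtain ⟨f, hf, rfl⟩ := (Submodule.mem_iSup_iff_exists_finsupp _ _).1 hx
  exact ⟨f.support, f, hf, rfl⟩

variable [SMulCommClass F A A] [IsScalarTower F A A]

/-- Every ideal is the sum of the simple ideals that it contains. -/
theorem SimpleDecomp.ideal_eq (h : SimpleDecomp J) {I : Submodule F A} (hI : IsIdeal I) :
    I = ⨆ (i) (_ : (J i).toSubmodule ≤ I), (J i).toSubmodule := by
  classical
  refine le_antisymm (fun x hx => ?_) (iSup₂_le fun i hi => hi)
  obtain ⟨s, f, hf, rfl⟩ := h.exists_sum x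
  refine Submodule.sum_mem _ fun i hi => ?_
  by_cases h0 : f i = 0
  · rw [h0]; exact zero_mem _
  refine Submodule.mem_iSup_of_mem i (Submodule.mem_iSup_of_mem ?_ (hf i))
  refine (h.le_or_disjoint hI i).resolve_right fun hd => ?_
  -- Multiplication by an element of `J i` sees only the `i`-th summand of the sum, and the result
  -- lies in `J i ⊓ I`, which is zero. So `f i` would annihilate the simple algebra `J i`.
  have key : ∀ y ∈ J i, y * f i = 0 ∧ f i * y = 0 := by
    intro y hy
    have e1 : y * ∑ i ∈ s, f i = y * f i := by
      rw [Finset.mul_sum]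
      exact Finset.sum_eq_single_of_mem i hi fun j _ hj => h.mul_eq_zero (Ne.symm hj) hy (hf j)
    have e2 : (∑ i ∈ s, f i) * y = f i * y := by
      rw [Finset.sum_mul]
      exact Finset.sum_eq_single_of_mem i hi fun j _ hj => h.mul_eq_zero hj (hf j) hy
    have m1 : y * f i ∈ (J i).toSubmodule ⊓ I := ⟨(J i).mul_mem hy (hf i), e1 ▸ (hI y _ hx).1⟩
    have m2 : f i * y ∈ (J i).toSubmodule ⊓ I := ⟨(J i).mul_mem (hf i) hy, e2 ▸ (hI y _ hx).2⟩
    rw [hd] at m1 m2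
    exact ⟨m1, m2⟩
  obtain ⟨y, hy⟩ := (h.isSimple i).exists_mul_ne_zero (x := ⟨f i, hf i⟩)
    (fun e => h0 (congrArg Subtype.val e))
  rcases hy with hy | hy
  · exact hy (Subtype.ext (key y y.2).1)
  · exact hy (Subtype.ext (key y y.2).2)

theorem SimpleDecomp.exists_le (h : SimpleDecomp J) {I : Submodule F A} (hI : IsIdeal I)
    (h0 : I ≠ ⊥) : ∃ i, (J i).toSubmodule ≤ I := by
  by_contra! hn
  apply h0
  rw [h.ideal_eq hI]
  simp [hn]

theorem SimpleDecomp.exists_mul_ne_zero (h : SimpleDecomp J) {I : Submodule F A}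
    (hI : IsIdeal I) (h0 : I ≠ ⊥) : ∃ x ∈ I, ∃ y ∈ I, x * y ≠ 0 := by
  obtain ⟨i, hi⟩ := h.exists_le hI h0
  obtain ⟨x, y, hxy⟩ := (h.isSimple i).1
  exact ⟨x, hi x.2, y, hi y.2, fun e => hxy (Subtype.ext e)⟩

/-- The elements whose products with `I` vanish. -/
def annihilator (I : Submodule F A) : Submodule F A where
  carrier := {x | ∀ y ∈ I, y * x = 0 ∧ x * y = 0}
  add_mem' := fun {a b} ha hb y hy => by simp [mul_add, add_mul, ha y hy, hb y hy]
  zero_mem' := fun y _ => by simp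
  smul_mem' := fun c a ha y hy => by simp [mul_smul_comm, smul_mul_assoc, ha y hy]

theorem SimpleDecomp.le_annihilator (h : SimpleDecomp J) {I : Submodule F A} (hI : IsIdeal I)
    {i : ι} (hi : ¬ (J i).toSubmodule ≤ I) : (J i).toSubmodule ≤ annihilator I := by
  have hd := (h.le_or_disjoint hI i).resolve_left hi
  intro x hx y hy
  have m1 : y * x ∈ (J i).toSubmodule ⊓ I := ⟨(h.isIdeal i y x hx).1, (hI x y hy).2⟩
  have m2 : x * y ∈ (J i).toSubmodule ⊓ I := ⟨(h.isIdeal i y x hx).2, (hI x y hy).1⟩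
  rw [hd] at m1 m2
  exact ⟨m1, m2⟩

/-- An element killing `I` has no nonzero component in a summand contained in `I`, since that
component would annihilate a simple algebra. -/
theorem SimpleDecomp.annihilator_eq (h : SimpleDecomp J) {I : Submodule F A} (hI : IsIdeal I) :
    annihilator I = ⨆ (i) (_ : ¬ (J i).toSubmodule ≤ I), (J i).toSubmodule := by
  classical
  refine le_antisymm (fun x hx => ?_) (iSup₂_le fun i hi => h.le_annihilator hI hi)
  obtain ⟨s, f, hf, rfl⟩ := h.exists_sum x
  refine Submodule.sum_mem _ fun i hi => ?_
  by_cases h0 : f i = 0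
  · rw [h0]; exact zero_mem _
  refine Submodule.mem_iSup_of_mem i (Submodule.mem_iSup_of_mem (fun hle => ?_) (hf i))
  obtain ⟨y, hy⟩ := (h.isSimple i).exists_mul_ne_zero (x := ⟨f i, hf i⟩)
    (fun e => h0 (congrArg Subtype.val e))
  have e1 : y.1 * ∑ i ∈ s, f i = y.1 * f i := by
    rw [Finset.mul_sum]
    exact Finset.sum_eq_single_of_mem i hi fun j _ hj => h.mul_eq_zero (Ne.symm hj) y.2 (hf j)
  have e2 : (∑ i ∈ s, f i) * y.1 = f i * y.1 := by
    rw [Finset.sum_mul]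
    exact Finset.sum_eq_single_of_mem i hi fun j _ hj => h.mul_eq_zero hj (hf j) y.2
  have := hx y.1 (hle y.2)
  rw [e1, e2] at this
  rcases hy with hy | hy
  · exact hy (Subtype.ext this.1)
  · exact hy (Subtype.ext this.2)

/-- Without associativity the annihilator of an ideal need not be an ideal; here this is read off
from its description as a sum of the `J i`. -/
theorem SimpleDecomp.isIdeal_annihilator (h : SimpleDecomp J) {I : Submodule F A}
    (hI : IsIdeal I) : IsIdeal (annihilator I) := by
  rw [h.annihilator_eq hI]
  exact IsIdeal.iSup fun i => IsIdeal.iSup fun _ => h.isIdeal i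

theorem SimpleDecomp.sup_annihilator (h : SimpleDecomp J) {I : Submodule F A}
    (hI : IsIdeal I) : I ⊔ annihilator I = ⊤ := by
  rw [eq_top_iff, ← h.iSup_eq_top]
  refine iSup_le fun i => ?_
  by_cases hi : (J i).toSubmodule ≤ I
  · exact le_sup_of_le_left hi
  · exact le_sup_of_le_right (h.le_annihilator hI hi)

theorem SimpleDecomp.inf_annihilator (h : SimpleDecomp J) {I : Submodule F A}
    (hI : IsIdeal I) : I ⊓ annihilator I = ⊥ := by
  by_contra h0
  obtain ⟨x, hx, y, hy, hxy⟩ := h.exists_mul_ne_zero (hI.inf (h.isIdeal_annihilator hI)) h0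
  exact hxy (hx.2 y hy.1).2

/-- Ideals of an ideal of a semisimple algebra are ideals of the algebra. -/
theorem SimpleDecomp.isIdeal_map_subtype (h : SimpleDecomp J) {I : Submodule F A}
    (hI : IsIdeal I) {L : Submodule F hI.toSubalgebra} (hL : IsIdeal L) :
    IsIdeal (L.map hI.toSubalgebra.toSubmodule.subtype) := by
  rintro a _ ⟨x, hx, rfl⟩
  -- The complement of `I` kills `I`, so only the component of `a` in `I` acts on `x`.
  have ha : a ∈ I ⊔ annihilator I := by rw [h.sup_annihilator hI]; trivial
  obtain ⟨b, hb, c, hc, rfl⟩ := Submodule.mem_sup.1 ha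
  have hxI : x.1 ∈ I := x.2
  have := hL ⟨b, hb⟩ x hx
  refine ⟨⟨_, this.1, ?_⟩, ⟨_, this.2, ?_⟩⟩
  · change b * x.1 = (b + c) * x.1
    rw [add_mul, (hc x.1 hxI).2, add_zero]
  · change x.1 * b = x.1 * (b + c)
    rw [mul_add, (hc x.1 hxI).1, add_zero]

/-- The simple summands are the `J i` contained in `I`; they span it by `SimpleDecomp.ideal_eq`. -/
theorem SimpleDecomp.isSemisimpleAlg_ideal [Finite ι] (h : SimpleDecomp J) {I : Submodule F A}
    (hI : IsIdeal I) : IsSemisimpleAlg F hI.toSubalgebra := by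
  let κ := {i // (J i).toSubmodule ≤ I}
  let J' : κ → NonUnitalSubalgebra F hI.toSubalgebra := fun k =>
    { toSubmodule := (J k.1).toSubmodule.comap hI.toSubalgebra.toSubmodule.subtype
      mul_mem' := fun {x y} hx hy => (J k.1).mul_mem hx hy }
  have hJ' : SimpleDecomp J' := by
    refine ⟨fun k a x hx => h.isIdeal k.1 a.1 x.1 hx, fun k => ?_, ?_, ?_⟩
    · refine ⟨?_, fun L hL => ?_⟩
      · obtain ⟨x, y, hxy⟩ := (h.isSimple k.1).1
        refine ⟨⟨⟨x.1, k.2 x.2⟩, x.2⟩, ⟨⟨y.1, k.2 y.2⟩, y.2⟩, fun e => hxy (Subtype.ext ?_)⟩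
        exact congrArg (fun z : J' k => z.1.1) e
      · let e : J k.1 →ₗ[F] J' k :=
          { toFun := fun x => ⟨⟨x.1, k.2 x.2⟩, x.2⟩
            map_add' := fun _ _ => rfl
            map_smul' := fun _ _ => rfl }
        have h1 : IsIdeal (L.comap e) := fun a x hx => hL (e a) (e x) hx
        have hin : ∀ y : J' k, ∃ x, e x = y := fun y => ⟨⟨y.1.1, y.2⟩, rfl⟩
        rcases (h.isSimple k.1).2 _ h1 with h2 | h2
        · left
          rw [eq_bot_iff]
          intro y hy
          obtain ⟨x, rfl⟩ := hin y
          have hx : x ∈ L.comap e := hy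
          rw [h2] at hx
          have hx : x = 0 := hx
          rw [hx, map_zero]
          exact zero_mem _
        · right
          rw [eq_top_iff]
          intro y _
          obtain ⟨x, rfl⟩ := hin y
          have hx : x ∈ L.comap e := by rw [h2]; trivial
          exact hx
    · exact GrAlg.iSupIndep_comap_subtype hI.toSubalgebra.toSubmodule
        (h.indep.comp (Subtype.val_injective (p := fun i => (J i).toSubmodule ≤ I)))
    · refine Submodule.map_injective_of_injective
        hI.toSubalgebra.toSubmodule.injective_subtype ?_
      rw [Submodule.map_iSup, Submodule.map_top, Submodule.range_subtype]
      refine Eq.trans ?_ (h.ideal_eq hI).symm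
      rw [iSup_subtype']
      refine iSup_congr fun k => ?_
      exact (Submodule.map_comap_subtype _ _).trans (inf_eq_right.2 k.2)
  exact hJ'.isSemisimpleAlg

end Semisimple

/-! ### Decomposition into minimal graded ideals -/

namespace GrAlg

variable {F : Type*} [Field F] {G : Type*} [CommGroup G] {B : GrAlg F G}

/-- A graded ideal, as a graded algebra. -/
def ofIdeal {I : Submodule F B} (hI : B.IsGradedIdeal I) : GrAlg F G where
  carrier := hI.1.toSubalgebra
  comp g := (B.comp g).comap hI.1.toSubalgebra.toSubmodule.subtype
  iSupIndep_comp := iSupIndep_comap_subtype _ B.iSupIndep_comp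
  iSup_comp := by
    refine Submodule.map_injective_of_injective
      hI.1.toSubalgebra.toSubmodule.injective_subtype ?_
    rw [Submodule.map_iSup, Submodule.map_top, Submodule.range_subtype]
    refine Eq.trans ?_ hI.2.symm
    exact iSup_congr fun g => Submodule.map_comap_subtype _ _
  mul_mem hx hy := B.mul_mem hx hy

theorem IsGradedIdeal.inf {I J : Submodule F B} (hI : B.IsGradedIdeal I)
    (hJ : B.IsGradedIdeal J) : B.IsGradedIdeal (I ⊓ J) := by
  rw [isGradedIdeal_iff] at *
  exact ⟨hI.1.inf hJ.1, fun x hx g => ⟨hI.2 x hx.1 g, hJ.2 x hx.2 g⟩⟩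

variable {ι : Type*} {J : ι → NonUnitalSubalgebra F B}

/-- Multiplication by a homogeneous element shifts components, so if `x` kills the homogeneous
components of `y`, which again lie in `I`, then so does each component of `x`. -/
theorem isGradedIdeal_annihilator (h : SimpleDecomp J) {I : Submodule F B}
    (hI : B.IsGradedIdeal I) : B.IsGradedIdeal (annihilator I) := by
  refine isGradedIdeal_iff.2 ⟨h.isIdeal_annihilator hI.1, fun x hx g y hy => ?_⟩
  have hI' := (isGradedIdeal_iff.1 hI).2
  obtain ⟨s, hs, -⟩ := B.exists_eq_sum_proj y
  have key : ∀ k, B.proj k y * B.proj g x = 0 ∧ B.proj g x * B.proj k y = 0 := by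
    intro k
    have := hx _ (hI' y hy k)
    rw [← proj_mul_left (proj_mem k y), ← proj_mul_right (proj_mem k y), this.1, this.2]
    simp
  rw [hs, Finset.mul_sum, Finset.sum_mul]
  exact ⟨Finset.sum_eq_zero fun k _ => (key k).1, Finset.sum_eq_zero fun k _ => (key k).2⟩

/-- Ideals of `I` are ideals of `B` by `SimpleDecomp.isIdeal_map_subtype`, so minimality in `B`
suffices. -/
theorem isGradedSimple_ofIdeal (h : SimpleDecomp J) {I : Submodule F B}
    (hI : B.IsGradedIdeal I) (h0 : I ≠ ⊥)
    (hmin : ∀ L ≤ I, B.IsGradedIdeal L → L = ⊥ ∨ L = I) : (ofIdeal hI).IsGradedSimple := by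
  constructor
  · obtain ⟨x, hx, y, hy, hxy⟩ := h.exists_mul_ne_zero hI.1 h0
    exact ⟨⟨x, hx⟩, ⟨y, hy⟩, fun e => hxy (congrArg Subtype.val e)⟩
  · intro L hL
    let s := hI.1.toSubalgebra.toSubmodule.subtype
    have hs : Function.Injective s := hI.1.toSubalgebra.toSubmodule.injective_subtype
    have h1 : B.IsGradedIdeal (L.map s) := by
      refine isGradedIdeal_iff.2 ⟨h.isIdeal_map_subtype hI.1 hL.1, ?_⟩
      rintro _ ⟨x, hx, rfl⟩ g
      refine ⟨(ofIdeal hI).proj g x, (isGradedIdeal_iff.1 hL).2 x hx g, ?_⟩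
      exact (proj_comm (B := ofIdeal hI) (C := B) s (fun g => g) Function.injective_id
        (fun g x hx => hx) g x).symm
    have hle : L.map s ≤ I := by
      rintro _ ⟨x, -, rfl⟩
      exact x.2
    rcases hmin _ hle h1 with h2 | h2
    · left
      exact Submodule.map_injective_of_injective hs (h2.trans (Submodule.map_bot _).symm)
    · right
      refine Submodule.map_injective_of_injective hs (h2.trans ?_)
      exact ((Submodule.map_top s).trans (Submodule.range_subtype _)).symm

/-- The smallest graded ideal that contains `S`. -/
def gradedClosure (B : GrAlg F G) (S : Submodule F B) : Submodule F B :=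
  sInf {I | B.IsGradedIdeal I ∧ S ≤ I}

theorem le_gradedClosure (S : Submodule F B) : S ≤ B.gradedClosure S :=
  le_sInf fun _ hI => hI.2

theorem gradedClosure_le {S I : Submodule F B} (hI : B.IsGradedIdeal I) (h : S ≤ I) :
    B.gradedClosure S ≤ I :=
  sInf_le ⟨hI, h⟩

theorem isGradedIdeal_gradedClosure (S : Submodule F B) :
    B.IsGradedIdeal (B.gradedClosure S) := by
  refine isGradedIdeal_iff.2 ⟨fun a x hx => ?_, fun x hx g => ?_⟩
  · simp only [gradedClosure, Submodule.mem_sInf] at hx ⊢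
    exact ⟨fun I hI => (hI.1.1 a x (hx I hI)).1, fun I hI => (hI.1.1 a x (hx I hI)).2⟩
  · simp only [gradedClosure, Submodule.mem_sInf] at hx ⊢
    exact fun I hI => (isGradedIdeal_iff.1 hI.1).2 x (hx I hI) g

/-- If `J i` is not inside `L`, it lies in the annihilator of `L`. That annihilator is a graded
ideal, so it contains the whole closure, hence `L` itself, and `L` meets its annihilator in zero. -/
theorem gradedClosure_minimal (h : SimpleDecomp J) (i : ι) {L : Submodule F B}
    (hle : L ≤ B.gradedClosure (J i).toSubmodule) (hL : B.IsGradedIdeal L) :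
    L = ⊥ ∨ L = B.gradedClosure (J i).toSubmodule := by
  by_cases hi : (J i).toSubmodule ≤ L
  · exact Or.inr (le_antisymm hle (gradedClosure_le hL hi))
  · left
    rw [eq_bot_iff, ← h.inf_annihilator hL.1]
    exact le_inf le_rfl (hle.trans
      (gradedClosure_le (isGradedIdeal_annihilator h hL) (h.le_annihilator hL.1 hi)))

/-- A decomposition into minimal graded ideals is an isomorphism with a product. -/
theorem isomorphic_prod {n : ℕ} {K : Fin n → Submodule F B} (hK : ∀ i, B.IsGradedIdeal (K i))
    (hind : iSupIndep K) (htop : ⨆ i, K i = ⊤) :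
    B.Isomorphic (prod fun i => ofIdeal (hK i)) := by
  have hmul : ∀ i j, i ≠ j → ∀ x ∈ K i, ∀ y ∈ K j, x * y = 0 := by
    intro i j hij x hx y hy
    have : x * y ∈ K i ⊓ K j := ⟨((hK i).1 y x hx).2, ((hK j).1 x y hy).1⟩
    rw [(hind.pairwiseDisjoint hij).eq_bot] at this
    exact this
  let ψ : (∀ i, ofIdeal (hK i)) →ₙₐ[F] B :=
    { toFun := fun x => ∑ i, (x i).1
      map_smul' := fun c x => by
        rw [Finset.smul_sum]; rfl
      map_zero' := Finset.sum_eq_zero fun i _ => rfl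
      map_add' := fun x y => by
        rw [← Finset.sum_add_distrib]; rfl
      map_mul' := fun x y => by
        rw [Finset.sum_mul]
        refine Finset.sum_congr rfl fun i _ => ?_
        rw [Finset.mul_sum, Finset.sum_eq_single_of_mem i (Finset.mem_univ i)
          fun j _ hj => hmul i j (Ne.symm hj) _ (x i).2 _ (y j).2]
        rfl }
  have hψ : ∀ x, ψ x = ∑ i, (x i).1 := fun _ => rfl
  refine Isomorphic.symm ?_
  refine isomorphic_of_bijective (B := prod fun i => ofIdeal (hK i)) ψ ⟨?_, ?_⟩ ?_
  · have h0 : ∀ x, ψ x = 0 → x = 0 := by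
      intro x hx
      funext i
      exact Subtype.ext ((iSupIndep_iff_finsetSum_eq_zero_imp_eq_zero _).1 hind Finset.univ
        (fun i => (x i).1) (fun i _ => (x i).2) hx i (Finset.mem_univ i))
    intro x y hxy
    exact sub_eq_zero.1 (h0 (x - y) ((map_sub ψ x y).trans (sub_eq_zero.2 hxy)))
  · intro b
    have hb : b ∈ ⨆ i, K i := by rw [htop]; trivial
    obtain ⟨f, hf, hfb⟩ := (Submodule.mem_iSup_iff_exists_finsupp _ _).1 hb
    refine ⟨fun i => ⟨f i, hf i⟩, ?_⟩
    rw [← hfb, Finsupp.sum_fintype _ _ fun _ => rfl]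
    rfl
  · intro g x hx
    exact Submodule.sum_mem (B.comp g) (t := Finset.univ) (f := fun i => (x i).1)
      fun i _ => hx i trivial

/-- A semisimple graded algebra is a product of graded-simple semisimple ones. -/
theorem exists_isomorphic_prod {B : GrAlg.{w} F G} (hB : IsSemisimpleAlg F B) :
    ∃ (n : ℕ) (C : Fin n → GrAlg.{w} F G),
      (∀ i, (C i).IsGradedSimple ∧ IsSemisimpleAlg F (C i)) ∧ B.Isomorphic (prod C) := by
  obtain ⟨n, J, h⟩ := isSemisimpleAlg_iff.1 hB
  let P : Fin n → Submodule F B := fun i => B.gradedClosure (J i).toSubmodule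
  -- Several `J i` may have the same graded closure, so the factors are indexed by the set of
  -- closures.
  obtain ⟨m, ⟨e⟩⟩ := Finite.exists_equiv_fin (Set.range P)
  let K : Fin m → Submodule F B := fun j => (e.symm j).1
  have hP : ∀ j, ∃ i, K j = P i := fun j => by
    obtain ⟨i, hi⟩ := (e.symm j).2
    exact ⟨i, hi.symm⟩
  have hKinj : Function.Injective K := Subtype.val_injective.comp e.symm.injective
  have hK : ∀ j, B.IsGradedIdeal (K j) := fun j => by
    obtain ⟨i, hi⟩ := hP j
    rw [hi]
    exact isGradedIdeal_gradedClosure _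
  have hK0 : ∀ j, K j ≠ ⊥ := fun j h0 => by
    obtain ⟨i, hi⟩ := hP j
    obtain ⟨x, y, hxy⟩ := (h.isSimple i).1
    apply hxy
    have : (x * y).1 ∈ K j := hi ▸ le_gradedClosure _ (x * y).2
    rw [h0] at this
    exact Subtype.ext this
  have hmin : ∀ j, ∀ L ≤ K j, B.IsGradedIdeal L → L = ⊥ ∨ L = K j := fun j L => by
    obtain ⟨i, hi⟩ := hP j
    rw [hi]
    exact fun h1 h2 => gradedClosure_minimal h i h1 h2
  have htop : ⨆ j, K j = ⊤ := by
    rw [eq_top_iff, ← h.iSup_eq_top]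
    refine iSup_le fun i => (le_gradedClosure _).trans ?_
    refine le_iSup_of_le (e ⟨P i, i, rfl⟩) ?_
    simp [K, P]
  -- Distinct minimal graded ideals meet in zero and therefore kill each other. Independence
  -- follows, since `K j` meets its annihilator in zero.
  have hle : ∀ j k, k ≠ j → K k ≤ annihilator (K j) := by
    intro j k hkj
    have h1 : K k ⊓ K j = ⊥ := by
      refine (hmin k _ inf_le_left ((hK k).inf (hK j))).resolve_right fun h1 => ?_
      rw [inf_eq_left] at h1
      rcases hmin j _ h1 (hK k) with h2 | h2
      · exact hK0 k h2
      · exact hkj (hKinj h2)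
    intro x hx y hy
    have m1 : y * x ∈ K k ⊓ K j := ⟨((hK k).1 y x hx).1, ((hK j).1 x y hy).2⟩
    have m2 : x * y ∈ K k ⊓ K j := ⟨((hK k).1 y x hx).2, ((hK j).1 x y hy).1⟩
    rw [h1] at m1 m2
    exact ⟨m1, m2⟩
  have hind : iSupIndep K := fun j => by
    rw [disjoint_iff, eq_bot_iff, ← h.inf_annihilator (hK j).1]
    exact inf_le_inf_left _ (iSup₂_le fun k hk => hle j k hk)
  exact ⟨m, fun j => ofIdeal (hK j),
    fun j => ⟨isGradedSimple_ofIdeal h (hK j) (hK0 j) (hmin j), h.isSemisimpleAlg_ideal (hK j).1⟩,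
    isomorphic_prod hK hind htop⟩

end GrAlg

/-! ### Loop algebras in terms of maps bijective on components -/

namespace GrAlg

variable {F : Type*} [Field F] {G : Type*} [CommGroup G] {B : GrAlg F G}
  {G' : Type*} [CommGroup G'] {A : GrAlg F G'}

/-- A homomorphism that maps `B_g` bijectively onto `A_{π(g)}` for all `g`. -/
structure IsLoopMap (π : G →* G') (q : B →ₙₐ[F] A) : Prop where
  injOn : ∀ g, ∀ x ∈ B.comp g, q x = 0 → x = 0
  map_comp : ∀ g, (B.comp g).map (q : B →ₗ[F] A) = A.comp (π g)

theorem IsLoopMap.mem {π : G →* G'} {q : B →ₙₐ[F] A} (hq : IsLoopMap π q) {g : G} {x : B}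
    (hx : x ∈ B.comp g) : q x ∈ A.comp (π g) := by
  rw [← hq.map_comp g]
  exact ⟨x, hx, rfl⟩

theorem IsLoopMap.surjective {π : G →* G'} {q : B →ₙₐ[F] A} (hq : IsLoopMap π q)
    (hπ : Function.Surjective π) : Function.Surjective q := by
  have : LinearMap.range (q : B →ₗ[F] A) = ⊤ := by
    rw [eq_top_iff, ← A.iSup_comp]
    refine iSup_le fun g' => ?_
    obtain ⟨g, rfl⟩ := hπ g'
    rw [← hq.map_comp g]
    exact LinearMap.map_le_range
  exact LinearMap.range_eq_top.1 this

open scoped TensorProduct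

/-- Compose the isomorphism with `a ⊗ m ↦ aug m • a`: the augmentation sends every group element to
`1`, so it identifies `A_{π(g)} ⊗ g` with `A_{π(g)}`. -/
theorem Isomorphic.exists_isLoopMap {π : G →* G'} (h : B.Isomorphic (loop π A)) :
    ∃ q : B →ₙₐ[F] A, IsLoopMap π q := by
  obtain ⟨φ, hφ, hg⟩ := h
  let aug : MonoidAlgebra F G →ₐ[F] F := MonoidAlgebra.lift F F G 1
  let ε : A ⊗[F] MonoidAlgebra F G →ₗ[F] A :=
    (TensorProduct.rid F A).toLinearMap ∘ₗ LinearMap.lTensor A aug.toLinearMap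
  have hε : ∀ a m, ε (a ⊗ₜ m) = aug m • a := fun a m => by simp [ε]
  have hmul : ∀ x y, ε (x * y) = ε x * ε y := by
    intro x y
    induction x using TensorProduct.induction_on with
    | zero => simp
    | add x x' hx hx' => rw [add_mul, map_add, map_add, hx, hx', add_mul]
    | tmul a m =>
      induction y using TensorProduct.induction_on with
      | zero => simp
      | add y y' hy hy' => rw [mul_add, map_add, map_add, hy, hy', mul_add]
      | tmul b n =>
        rw [Algebra.TensorProduct.tmul_mul_tmul, hε, hε, hε, map_mul, smul_mul_assoc,
          mul_smul_comm, mul_smul]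
  have haug : ∀ g, aug (MonoidAlgebra.single g 1) = 1 := fun g => by
    simp [aug, MonoidAlgebra.lift_single]
  let q : B →ₙₐ[F] A :=
    { toFun := fun x => ε (φ x).1
      map_smul' := fun c x => by
        rw [map_smul]; exact map_smul ε c (φ x).1
      map_zero' := by
        rw [map_zero]; exact map_zero ε
      map_add' := fun x y => by
        rw [map_add]; exact map_add ε (φ x).1 (φ y).1
      map_mul' := fun x y => by
        rw [map_mul]; exact hmul (φ x).1 (φ y).1 }
  have hq : ∀ x, q x = ε (φ x).1 := fun _ => rfl
  refine ⟨q, fun g x hx h0 => ?_, fun g => le_antisymm ?_ ?_⟩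
  · have h1 : φ x ∈ (loop π A).comp g := by
      rw [← hg g]
      exact ⟨x, hx, rfl⟩
    obtain ⟨a, ha, hax⟩ := h1
    have hax : a ⊗ₜ[F] MonoidAlgebra.single g 1 = (φ x).1 := hax
    rw [hq, ← hax, hε, haug, one_smul] at h0
    rw [h0, TensorProduct.zero_tmul] at hax
    refine hφ.1 ?_
    rw [map_zero]
    exact Subtype.ext hax.symm
  · rintro _ ⟨x, hx, rfl⟩
    have h1 : φ x ∈ (loop π A).comp g := by
      rw [← hg g]
      exact ⟨x, hx, rfl⟩
    obtain ⟨a, ha, hax⟩ := h1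
    have hax : a ⊗ₜ[F] MonoidAlgebra.single g 1 = (φ x).1 := hax
    change q x ∈ _
    rwa [hq, ← hax, hε, haug, one_smul]
  · intro a ha
    have hmem : a ⊗ₜ[F] MonoidAlgebra.single g 1 ∈ loopComp π A g := ⟨a, ha, rfl⟩
    let y : loop π A := ⟨a ⊗ₜ[F] MonoidAlgebra.single g 1,
      Submodule.mem_iSup_of_mem (p := loopComp π A) g hmem⟩
    have hy : y ∈ (loop π A).comp g := hmem
    rw [← hg g] at hy
    obtain ⟨x, hx, hxy⟩ := hy
    have hxy : φ x = y := hxy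
    refine ⟨x, hx, ?_⟩
    change q x = a
    rw [hq, hxy, hε, haug, one_smul]

/-- The isomorphism is `x ↦ q x ⊗ g` on `B_g`; the second factor records the degree that `q`
forgets. -/
theorem IsLoopMap.isomorphic_loop {π : G →* G'} {q : B →ₙₐ[F] A} (hq : IsLoopMap π q) :
    B.Isomorphic (loop π A) := by
  classical
  let s : G → A →ₗ[F] A ⊗[F] MonoidAlgebra F G := fun g =>
    (TensorProduct.mk F A (MonoidAlgebra F G)).flip (MonoidAlgebra.single g 1)
  let Φ : B →ₗ[F] A ⊗[F] MonoidAlgebra F G :=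
    B.lift fun g => s g ∘ₗ (q : B →ₗ[F] A) ∘ₗ (B.comp g).subtype
  have hΦ : ∀ g, ∀ x ∈ B.comp g, Φ x = q x ⊗ₜ MonoidAlgebra.single g 1 := fun g x hx =>
    B.lift_of_mem _ hx
  have hΦmem : ∀ g, ∀ x ∈ B.comp g, Φ x ∈ loopComp π A g := fun g x hx => by
    rw [hΦ g x hx]
    exact ⟨q x, hq.mem hx, rfl⟩
  have hmul : ∀ x y, Φ (x * y) = Φ x * Φ y :=
    map_mul_of_homogeneous fun g k x hx y hy => by
      rw [hΦ g x hx, hΦ k y hy, hΦ _ _ (B.mul_mem hx hy)]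
      simp [Algebra.TensorProduct.tmul_mul_tmul, MonoidAlgebra.single_mul_single]
  have hrange : ∀ x, Φ x ∈ loopSubalgebra π A := fun x => by
    refine hom_induction (p := fun x => Φ x ∈ loopSubalgebra π A) (fun g x hx => ?_) ?_ ?_ x
    · exact Submodule.mem_iSup_of_mem (p := loopComp π A) g (hΦmem g x hx)
    · rw [map_zero]; exact zero_mem _
    · intro x y hx hy
      rw [map_add]; exact add_mem hx hy
  -- Taking the coefficient at `g` recovers the image under `q` of the component of degree `g`,
  -- whence injectivity.
  let coef : G → A ⊗[F] MonoidAlgebra F G →ₗ[F] A := fun g =>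
    (TensorProduct.rid F A).toLinearMap ∘ₗ LinearMap.lTensor A
      (Finsupp.lapply g ∘ₗ (MonoidAlgebra.coeffLinearEquiv F :
        MonoidAlgebra F G ≃ₗ[F] (G →₀ F)).toLinearMap)
  have hcoef : ∀ g x, coef g (Φ x) = q (B.proj g x) := by
    intro g x
    refine congrArg (fun f : B →ₗ[F] A => f x)
      (linearMap_ext (f := coef g ∘ₗ Φ) (f' := (q : B →ₗ[F] A) ∘ₗ B.proj g) fun k x hx => ?_)
    change coef g (Φ x) = q (B.proj g x)
    rw [hΦ k x hx]
    by_cases h : k = g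
    · subst h
      simp [coef, proj_of_mem hx]
    · simp [coef, proj_of_mem_ne hx h, h]
  let φ : B →ₙₐ[F] loop π A :=
    { toFun := fun x => ⟨Φ x, hrange x⟩
      map_smul' := fun c x => Subtype.ext (map_smul Φ c x)
      map_zero' := Subtype.ext (map_zero Φ)
      map_add' := fun x y => Subtype.ext (map_add Φ x y)
      map_mul' := fun x y => Subtype.ext (hmul x y) }
  refine isomorphic_of_bijective φ ⟨?_, ?_⟩ fun g x hx => hΦmem g x hx
  · have h0 : ∀ x, φ x = 0 → x = 0 := fun x hx => eq_zero_of_proj fun g => by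
      refine hq.injOn g _ (proj_mem g x) ?_
      have : Φ x = 0 := congrArg Subtype.val hx
      rw [← hcoef, this, map_zero]
    intro x y hxy
    exact sub_eq_zero.1 (h0 (x - y) ((map_sub φ x y).trans (sub_eq_zero.2 hxy)))
  · rintro ⟨y, hy⟩
    have hle : (⨆ g, loopComp π A g) ≤ LinearMap.range Φ := by
      refine iSup_le fun g => ?_
      rintro _ ⟨a, ha, rfl⟩
      rw [← hq.map_comp g] at ha
      obtain ⟨x, hx, rfl⟩ := ha
      exact ⟨x, hΦ g x hx⟩
    obtain ⟨x, hx⟩ := hle hy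
    exact ⟨x, Subtype.ext hx⟩

end GrAlg

/-! ### Characters with values in an algebraically closed field -/

section Characters

/-- Characters with values in an algebraically closed field extend from subgroups. -/
theorem exists_character_extension {F : Type*} [Field F] [IsAlgClosed F] {G : Type*} [CommGroup G]
    {H : Subgroup G} (χ : H →* Fˣ) : ∃ X : G →* Fˣ, ∀ h : H, X h = χ h := by
  -- Since `F` has all roots, `Fˣ` is divisible and hence injective as an abelian group.
  have hroot : ∀ {n : ℕ}, n ≠ 0 → Function.Surjective (fun a : Fˣ => a ^ n) := by
    intro n hn a
    obtain ⟨z, hz⟩ := IsAlgClosed.exists_pow_nat_eq (a : F) (Nat.pos_of_ne_zero hn)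
    have hz0 : z ≠ 0 := by
      rintro rfl
      rw [zero_pow hn] at hz
      exact a.ne_zero hz.symm
    exact ⟨Units.mk0 z hz0, Units.ext (by simpa using hz)⟩
  let _ : DivisibleBy (Additive Fˣ) ℕ := divisibleByOfSMulRightSurj _ _ fun {n} hn a => by
    obtain ⟨b, hb⟩ := hroot hn a.toMul
    exact ⟨Additive.ofMul b, congrArg Additive.ofMul hb⟩
  let _ : DivisibleBy (Additive Fˣ) ℤ   := AddGroup.divisibleByIntOfDivisibleByNat _
  obtain ⟨X, hX⟩ := (Module.Baer.of_divisible (Additive Fˣ)).extension_property_addMonoidHom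
    (MonoidHom.toAdditive H.subtype) (fun a b h => Subtype.val_injective h)
    (MonoidHom.toAdditive χ)
  exact ⟨MonoidHom.toAdditive.symm X, fun h => DFunLike.congr_fun hX (Additive.ofMul h)⟩

variable {F : Type*} [Field F] [IsAlgClosed F] {H : Type*} [CommGroup H] [Fintype H]

theorem hasEnoughRootsOfUnity_exponent (hH : (Fintype.card H : F) ≠ 0) :
    HasEnoughRootsOfUnity F (Monoid.exponent H) := by
  have : NeZero (Monoid.exponent H : F) := ⟨fun h => hH (by
    obtain ⟨k, hk⟩ := Group.exponent_dvd_card (G := H)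
    rw [hk, Nat.cast_mul, h, zero_mul])⟩
  exact IsSepClosed.hasEnoughRootsOfUnity F _

-- For `h ≠ 1` some character `ψ` has `ψ h ≠ 1`, and translating the summation index by `ψ`
-- multiplies the sum by `ψ h`. For `h = 1` the sum counts the characters, of which there are `|H|`.
open scoped Classical in
theorem sum_characters_apply (hH : (Fintype.card H : F) ≠ 0) [Fintype (H →* Fˣ)] (h : H) :
    ∑ χ : H →* Fˣ, (χ h : F) = if h = 1 then (Fintype.card H : F) else 0 := by
  have := hasEnoughRootsOfUnity_exponent (F := F) hH
  split_ifs with h1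
  · subst h1
    have hc := CommGroup.card_monoidHom_of_hasEnoughRootsOfUnity H F
    simp only [Nat.card_eq_fintype_card] at hc
    simp [hc]
  · obtain ⟨ψ, hψ⟩ := CommGroup.exists_apply_ne_one_of_hasEnoughRootsOfUnity H F h1
    have h2 : (ψ h : F) * ∑ χ : H →* Fˣ, (χ h : F) = ∑ χ : H →* Fˣ, (χ h : F) := by
      rw [Finset.mul_sum]
      exact Fintype.sum_equiv (Equiv.mulLeft ψ) _ _ fun χ => by simp
    have h3 : ((ψ h : F) - 1) * ∑ χ : H →* Fˣ, (χ h : F) = 0 := by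
      rw [sub_mul, h2, one_mul, sub_self]
    refine (mul_eq_zero.1 h3).resolve_left fun h4 => hψ (Units.ext ?_)
    simpa using sub_eq_zero.1 h4

end Characters

/-! ### Groups acting through the centroid and their isotypic operators -/

namespace GrAlg

variable {F : Type*} [Field F] {G : Type*} [CommGroup G] {B : GrAlg F G}

/-- A homogeneous action of a subgroup of the grading group by elements of the centroid. -/
structure IsCentroidAction (H : Subgroup G) (c : H → B →ₗ[F] B) : Prop where
  mem : ∀ (h : H) (g : G), ∀ x ∈ B.comp g, c h x ∈ B.comp (h * g)
  one : ∀ x, c 1 x = x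
  mul : ∀ h k x, c (h * k) x = c h (c k x)
  isCentroidal : ∀ h, IsCentroidal (c h)

theorem isCentroidal_sum {A : Type*} [NonUnitalNonAssocRing A] [Module F A]
    [SMulCommClass F A A] [IsScalarTower F A A] {ι : Type*} (s : Finset ι)
    (r : ι → F) {c : ι → A →ₗ[F] A} (hc : ∀ i, IsCentroidal (c i)) :
    IsCentroidal (∑ i ∈ s, r i • c i) := by
  intro x y
  simp only [LinearMap.sum_apply, LinearMap.smul_apply, Finset.sum_mul, Finset.mul_sum,
    smul_mul_assoc, mul_smul_comm]
  exact ⟨Finset.sum_congr rfl fun i _ => by rw [(hc i x y).1],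
    Finset.sum_congr rfl fun i _ => by rw [(hc i x y).2]⟩

section Action

variable {H : Subgroup G} {c : H → B →ₗ[F] B} [Fintype H]

/-- The averaging operator of a character of `H`, up to the factor `|H|`. -/
def isotypic (c : H → B →ₗ[F] B) (χ : H →* Fˣ) : B →ₗ[F] B :=
  ∑ h, ((χ h)⁻¹ : Fˣ).val • c h

theorem isotypic_apply (χ : H →* Fˣ) (x : B) :
    isotypic c χ x = ∑ h, ((χ h)⁻¹ : Fˣ).val • c h x := by
  simp [isotypic]

namespace IsCentroidAction

theorem isCentroidal_isotypic (hc : IsCentroidAction H c) (χ : H →* Fˣ) :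
    IsCentroidal (isotypic c χ) :=
  isCentroidal_sum _ _ hc.isCentroidal

theorem isotypic_action (hc : IsCentroidAction H c) (χ : H →* Fˣ) (h : H) (x : B) :
    isotypic c χ (c h x) = (χ h : F) • isotypic c χ x := by
  rw [isotypic_apply, isotypic_apply, Finset.smul_sum]
  refine Fintype.sum_equiv (Equiv.mulRight h) _ _ fun k => ?_
  rw [← hc.mul]
  simp [smul_smul]

theorem action_isotypic (hc : IsCentroidAction H c) (χ : H →* Fˣ) (h : H) (x : B) :
    c h (isotypic c χ x) = (χ h : F) • isotypic c χ x := by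
  rw [isotypic_apply, map_sum, Finset.smul_sum]
  refine Fintype.sum_equiv (Equiv.mulLeft h) _ _ fun k => ?_
  rw [map_smul, ← hc.mul]
  simp [smul_smul, mul_left_comm (χ h : F)]

theorem isotypic_isotypic (hc : IsCentroidAction H c) (χ : H →* Fˣ) (x : B) :
    isotypic c χ (isotypic c χ x) = (Fintype.card H : F) • isotypic c χ x := by
  conv_lhs => rw [isotypic_apply]
  simp [hc.action_isotypic, smul_smul, Nat.cast_smul_eq_nsmul]

/-- Where `χ k ≠ ψ k`, apply `isotypic c χ` to `c k (isotypic c ψ x)`: the factor `c k` comes out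
both as `χ k` and as `ψ k`. -/
theorem isotypic_isotypic_of_ne (hc : IsCentroidAction H c) {χ ψ : H →* Fˣ} (h : χ ≠ ψ) (x : B) :
    isotypic c χ (isotypic c ψ x) = 0 := by
  obtain ⟨k, hk⟩ := DFunLike.ne_iff.1 h
  have h1 := hc.isotypic_action χ k (isotypic c ψ x)
  rw [hc.action_isotypic, map_smul] at h1
  by_contra h0
  exact hk (Units.ext (smul_left_injective F h0 h1).symm)

/-- The terms `c h x` have distinct degrees `h * g`, and only `h = 1` contributes in degree `g`. So
the operator is injective on each component in every characteristic, even when its square is zero.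
-/
theorem proj_isotypic (hc : IsCentroidAction H c) (χ : H →* Fˣ) {g : G} {x : B}
    (hx : x ∈ B.comp g) : B.proj g (isotypic c χ x) = x := by
  rw [isotypic_apply, map_sum, Finset.sum_eq_single 1]
  · simp [hc.one, proj_of_mem hx]
  · intro h _ h1
    rw [map_smul, proj_of_mem_ne (hc.mem h g x hx), smul_zero]
    intro e
    exact h1 (Subtype.ext (mul_eq_right.1 e))
  · simp

theorem isotypic_injOn (hc : IsCentroidAction H c) (χ : H →* Fˣ) {g : G} {x : B}
    (hx : x ∈ B.comp g) (h : isotypic c χ x = 0) : x = 0 := by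
  rw [← hc.proj_isotypic χ hx, h, map_zero]

theorem sum_isotypic [IsAlgClosed F] (hc : IsCentroidAction H c) [Fintype (H →* Fˣ)]
    (hH : (Fintype.card H : F) ≠ 0) (x : B) :
    ∑ χ : H →* Fˣ, isotypic c χ x = (Fintype.card H : F) • x := by
  classical
  simp only [isotypic_apply]
  rw [Finset.sum_comm]
  have h1 : ∀ h : H, ∑ χ : H →* Fˣ, ((χ h)⁻¹ : Fˣ).val • c h x =
      (if h = 1 then (Fintype.card H : F) else 0) • c h x := by
    intro h
    rw [← Finset.sum_smul]
    congr 1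
    have := sum_characters_apply (F := F) hH h⁻¹
    simpa using this
  rw [Finset.sum_congr rfl fun h _ => h1 h, Finset.sum_eq_single 1]
  · simp [hc.one]
  · intro h _ hh
    simp [hh]
  · simp

/-- In the modular case the trace of `H` has a nonzero ideal of square zero as its image. -/
theorem not_isSemisimpleAlg (hc : IsCentroidAction H c) (h0 : ∃ x : B, x ≠ 0)
    (hH : (Fintype.card H : F) = 0) : ¬ IsSemisimpleAlg F B := by
  intro hB
  obtain ⟨n, J, hJ⟩ := isSemisimpleAlg_iff.1 hB
  obtain ⟨x, hx⟩ := h0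
  have hT := hc.isCentroidal_isotypic 1
  have hne : LinearMap.range (isotypic c 1) ≠ ⊥ := by
    intro hr
    apply hx
    refine eq_zero_of_proj fun g => hc.isotypic_injOn 1 (proj_mem g x) ?_
    have : isotypic c 1 (B.proj g x) ∈ LinearMap.range (isotypic c 1) := ⟨_, rfl⟩
    rw [hr] at this
    exact this
  obtain ⟨_, ⟨a, rfl⟩, _, ⟨b, rfl⟩, hab⟩ :=
    hJ.exists_mul_ne_zero (isIdeal_range_of_isCentroidal hT) hne
  apply hab
  -- With `T = isotypic c 1`: `T a * T b = T (a * T b) = T (T (a * b)) = |H| • T (a * b) = 0`.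
  rw [← (hT a _).1, ← (hT a b).2, hc.isotypic_isotypic, hH, zero_smul]

end IsCentroidAction

end Action

/-! ### The action of the kernel of `π` and the semisimplicity criterion -/

variable {G' : Type*} [CommGroup G'] {A : GrAlg F G'} {π : G →* G'} {q : B →ₙₐ[F] A}

theorem IsLoopMap.exists_section (hq : IsLoopMap π q) (g : G) :
    ∃ s : A.comp (π g) →ₗ[F] B, ∀ a, s a ∈ B.comp g ∧ q (s a) = a := by
  let f : B.comp g →ₗ[F] A.comp (π g) :=
    { toFun := fun x => ⟨q x, hq.mem x.2⟩
      map_add' := fun x y => Subtype.ext (map_add q x.1 y.1)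
      map_smul' := fun r x => Subtype.ext (map_smul q r x.1) }
  have hf : Function.Bijective f := by
    constructor
    · rw [injective_iff_map_eq_zero]
      intro x hx
      exact Subtype.ext (hq.injOn g x x.2 (congrArg Subtype.val hx))
    · rintro ⟨a, ha⟩
      rw [← hq.map_comp g] at ha
      obtain ⟨x, hx, rfl⟩ := ha
      exact ⟨⟨x, hx⟩, rfl⟩
  let e := LinearEquiv.ofBijective f hf
  refine ⟨(B.comp g).subtype ∘ₗ e.symm.toLinearMap, fun a => ⟨(e.symm a).2, ?_⟩⟩
  exact congrArg Subtype.val (e.apply_symm_apply a)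

theorem IsLoopMap.eq_of_apply_eq (hq : IsLoopMap π q) {g : G} {x y : B} (hx : x ∈ B.comp g)
    (hy : y ∈ B.comp g) (h : q x = q y) : x = y :=
  sub_eq_zero.1 (hq.injOn g _ (sub_mem hx hy) (by rw [map_sub, h, sub_self]))

/-- `c h` goes from `B_g` to `B_{hg}` through the bijections of both with `A_{π(g)} = A_{π(hg)}`. As
`q ∘ c h = q` and `q` is injective on components, the required identities may be checked after
applying `q`. -/
theorem IsLoopMap.exists_action (hq : IsLoopMap π q) :
    ∃ c : π.ker → B →ₗ[F] B, IsCentroidAction π.ker c ∧ ∀ h x, q (c h x) = q x := by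
  choose s hs hqs using hq.exists_section
  have hmem : ∀ (h : π.ker) {g : G} {x : B}, x ∈ B.comp g → q x ∈ A.comp (π (h * g)) := by
    intro h g x hx
    rw [map_mul, h.2, one_mul]
    exact hq.mem hx
  let c : π.ker → B →ₗ[F] B := fun h => B.lift fun g => s (h * g) ∘ₗ
    { toFun := fun x => ⟨q x, hmem h x.2⟩
      map_add' := fun x y => Subtype.ext (map_add q x.1 y.1)
      map_smul' := fun r x => Subtype.ext (map_smul q r x.1) }
  have hcdef : ∀ (h : π.ker) {g : G} {x : B} (hx : x ∈ B.comp g),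
      c h x = s (h * g) ⟨q x, hmem h hx⟩ := fun h g x hx => B.lift_of_mem _ hx
  have hcm : ∀ (h : π.ker) (g : G), ∀ x ∈ B.comp g, c h x ∈ B.comp (h * g) := by
    intro h g x hx
    rw [hcdef h hx]
    exact hs _ _
  have hcq : ∀ h x, q (c h x) = q x := by
    intro h x
    refine congrArg (fun f : B →ₗ[F] A => f x) (linearMap_ext
      (f := (q : B →ₗ[F] A) ∘ₗ c h) (f' := (q : B →ₗ[F] A)) fun g x hx => ?_)
    change q (c h x) = q x
    rw [hcdef h hx, hqs]
  refine ⟨c, ⟨hcm, fun x => ?_, fun h k x => ?_, fun h => ?_⟩, hcq⟩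
  · refine congrArg (fun f : B →ₗ[F] B => f x)
      (linearMap_ext (f' := LinearMap.id) fun g x hx => ?_)
    refine hq.eq_of_apply_eq (g := g) ?_ hx (hcq 1 x)
    have := hcm 1 g x hx
    rwa [OneMemClass.coe_one, one_mul] at this
  · refine congrArg (fun f : B →ₗ[F] B => f x)
      (linearMap_ext (f' := c h ∘ₗ c k) fun g x hx => ?_)
    refine hq.eq_of_apply_eq (hcm (h * k) g x hx) ?_ ?_
    · have := hcm h _ _ (hcm k g x hx)
      rwa [← mul_assoc] at this
    · rw [LinearMap.comp_apply, hcq, hcq, hcq]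
  · refine isCentroidal_of_homogeneous fun g k x hx y hy => ⟨?_, ?_⟩
    · refine hq.eq_of_apply_eq (hcm h _ _ (B.mul_mem hx hy)) ?_ ?_
      · have := B.mul_mem (hcm h g x hx) hy
        rwa [mul_assoc] at this
      · rw [hcq, map_mul, map_mul, hcq]
    · refine hq.eq_of_apply_eq (hcm h _ _ (B.mul_mem hx hy)) ?_ ?_
      · have := B.mul_mem hx (hcm h k y hy)
        rwa [mul_left_comm] at this
      · rw [hcq, map_mul, map_mul, hcq]

theorem isSimpleAlg_of_retract {I : NonUnitalSubalgebra F B}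
    {A : Type*} [NonUnitalNonAssocRing A] [Module F A]
    (hA : IsSimpleAlg F A) (p : B →ₙₐ[F] A) (hp : ∀ a, ∃ x ∈ I, p x = a)
    (hinj : ∀ x ∈ I, p x = 0 → x = 0) : IsSimpleAlg F I := by
  constructor
  · obtain ⟨a, b, hab⟩ := hA.1
    obtain ⟨x, hx, rfl⟩ := hp a
    obtain ⟨y, hy, rfl⟩ := hp b
    refine ⟨⟨x, hx⟩, ⟨y, hy⟩, fun e => hab ?_⟩
    rw [← map_mul, show x * y = 0 from congrArg Subtype.val e, map_zero]
  · intro L hL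
    let p' : I →ₗ[F] A := (p : B →ₗ[F] A) ∘ₗ I.toSubmodule.subtype
    have hp' : ∀ x : I, p' x = p x.1 := fun _ => rfl
    have hinj' : Function.Injective p' := by
      rw [injective_iff_map_eq_zero]
      exact fun x hx => Subtype.ext (hinj x.1 x.2 hx)
    have hsurj' : Function.Surjective p' := fun a => by
      obtain ⟨x, hx, rfl⟩ := hp a
      exact ⟨⟨x, hx⟩, rfl⟩
    have h1 : IsIdeal (L.map p') := by
      rintro a _ ⟨x, hx, rfl⟩
      obtain ⟨y, rfl⟩ := hsurj' a
      refine ⟨⟨y * x, (hL y x hx).1, ?_⟩, ⟨x * y, (hL y x hx).2, ?_⟩⟩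
      · exact map_mul p y.1 x.1
      · exact map_mul p x.1 y.1
    rcases hA.2 _ h1 with h2 | h2
    · left
      exact Submodule.map_injective_of_injective hinj' (h2.trans (Submodule.map_bot _).symm)
    · right
      refine Submodule.map_injective_of_injective hinj' (h2.trans ?_)
      rw [Submodule.map_top, LinearMap.range_eq_top.2 hsurj']

/-- The homomorphism `x ↦ X(g) q(x)` for `x` of degree `g`. -/
theorem exists_twist (q : B →ₙₐ[F] A) (X : G →* Fˣ) :
    ∃ p : B →ₙₐ[F] A, ∀ g, ∀ x ∈ B.comp g, p x = (X g : F) • q x := by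
  let p : B →ₗ[F] A := B.lift fun g => (X g : F) • ((q : B →ₗ[F] A) ∘ₗ (B.comp g).subtype)
  have hp : ∀ g, ∀ x ∈ B.comp g, p x = (X g : F) • q x := fun g x hx => B.lift_of_mem _ hx
  have hmul := map_mul_of_homogeneous (f := p) fun g k x hx y hy => by
    rw [hp g x hx, hp k y hy, hp _ _ (B.mul_mem hx hy), map_mul, map_mul, Units.val_mul,
      smul_mul_assoc, mul_smul_comm, mul_smul]
  exact ⟨{ p with
    map_zero' := map_zero p
    map_mul' := hmul }, hp⟩

/-- After division by `|H|` the isotypic operators are orthogonal projections with sum the identity.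
Their images `J χ` are simple because the twist `p` of `q` by an extension `X` of `χ` to `G` maps `J
χ` bijectively onto `A`. -/
theorem IsLoopMap.isSemisimpleAlg [IsAlgClosed F] (hq : IsLoopMap π q)
    (hπ : Function.Surjective π) (hA : IsSimpleAlg F A) [Fintype π.ker]
    (hH : (Fintype.card π.ker : F) ≠ 0) : IsSemisimpleAlg F B := by
  classical
  obtain ⟨c, hc, hcq⟩ := hq.exists_action
  have := hasEnoughRootsOfUnity_exponent (F := F) hH
  have hfin : Finite (π.ker →* Fˣ) :=
    (CommGroup.monoidHom_mulEquiv_of_hasEnoughRootsOfUnity π.ker F).some.symm.finite_iff.1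
      inferInstance
  let _ : Fintype (π.ker →* Fˣ) := Fintype.ofFinite _
  let J : (π.ker →* Fˣ) → NonUnitalSubalgebra F B := fun χ =>
    (isIdeal_range_of_isCentroidal (hc.isCentroidal_isotypic χ)).toSubalgebra
  have hJ : ∀ χ, IsIdeal (J χ).toSubmodule := fun χ =>
    isIdeal_range_of_isCentroidal (hc.isCentroidal_isotypic χ)
  have hJe : ∀ χ, ∀ x ∈ (J χ).toSubmodule,
      isotypic c χ x = (Fintype.card π.ker : F) • x := by
    rintro χ _ ⟨x, rfl⟩
    exact hc.isotypic_isotypic χ x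
  choose s hs hqs using hq.exists_section
  choose l hl using hπ
  refine SimpleDecomp.isSemisimpleAlg (J := J) ⟨hJ, fun χ => ?_, ?_, ?_⟩
  · obtain ⟨X, hX⟩ := exists_character_extension χ
    obtain ⟨p, hp⟩ := exists_twist q X
    have hpc : ∀ h x, p (c h x) = (χ h : F) • p x := by
      intro h x
      refine congrArg (fun f : B →ₗ[F] A => f x) (linearMap_ext
        (f := (p : B →ₗ[F] A) ∘ₗ c h) (f' := (χ h : F) • (p : B →ₗ[F] A)) fun g x hx => ?_)
      change p (c h x) = (χ h : F) • p x
      rw [hp _ _ (hc.mem h g x hx), hp g x hx, hcq, map_mul, hX, Units.val_mul, mul_smul]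
    have hpe : ∀ x, p (isotypic c χ x) = (Fintype.card π.ker : F) • p x := by
      intro x
      rw [isotypic_apply, map_sum]
      simp [hpc, smul_smul, Nat.cast_smul_eq_nsmul]
    have hle : ∀ g', A.comp g' ≤ A.comp (π (l g')) := fun g' => by rw [hl]
    -- Designed so that `t ∘ p = isotypic c χ`, which makes `p` injective on `J χ`. On `A_{g'}` it
    -- lifts to the chosen degree `l g'`, undoes the twist and applies the isotypic operator.
    let t : A →ₗ[F] B := A.lift fun g' => ((X (l g'))⁻¹ : Fˣ).val •
      (isotypic c χ ∘ₗ s (l g') ∘ₗ Submodule.inclusion (hle g'))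
    have ht : ∀ x, t (p x) = isotypic c χ x := by
      intro x
      refine congrArg (fun f : B →ₗ[F] B => f x) (linearMap_ext
        (f := t ∘ₗ (p : B →ₗ[F] A)) fun g x hx => ?_)
      change t (p x) = _
      have hqx := hq.mem hx
      have h1 : t (q x) = ((X (l (π g)))⁻¹ : Fˣ).val •
          isotypic c χ (s (l (π g)) ⟨q x, hle _ hqx⟩) := A.lift_of_mem _ hqx
      -- The chosen degree differs from `g` by this `h`, and the isotypic operator turns `c h` into
      -- the scalar `χ h = X (l (π g)) * (X g)⁻¹`, which cancels the other two scalars.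
      let h : π.ker := ⟨l (π g) * g⁻¹, by rw [MonoidHom.mem_ker, map_mul, hl, map_inv]; simp⟩
      have h2 : s (l (π g)) ⟨q x, hle _ hqx⟩ = c h x := by
        refine hq.eq_of_apply_eq (hs _ _) ?_ ?_
        · have := hc.mem h g x hx
          simpa [h] using this
        · rw [hqs, hcq]
      rw [hp g x hx, map_smul, h1, h2, hc.isotypic_action, smul_smul, smul_smul, ← hX]
      simp only [h, map_mul, map_inv, ← Units.val_mul]
      simp
    refine isSimpleAlg_of_retract (I := J χ) hA p (fun a => ?_) fun x hx h0 => ?_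
    · obtain ⟨x, hx⟩ : ∃ x, p x = a := by
        refine hom_induction (p := fun a => ∃ x, p x = a) (fun g' a ha => ?_)
          ⟨0, map_zero p⟩ ?_ a
        · rw [← hl g', ← hq.map_comp] at ha
          obtain ⟨x, hx, rfl⟩ := ha
          refine ⟨((X (l g'))⁻¹ : Fˣ).val • x, ?_⟩
          rw [map_smul, hp _ x hx, smul_smul, ← Units.val_mul]
          simp
        · rintro _ _ ⟨x, rfl⟩ ⟨y, rfl⟩
          exact ⟨x + y, map_add p x y⟩
      refine ⟨isotypic c χ ((Fintype.card π.ker : F)⁻¹ • x), ⟨_, rfl⟩, ?_⟩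
      rw [hpe, map_smul, smul_smul, mul_inv_cancel₀ hH, one_smul, hx]
    · have h1 := hJe χ x hx
      rw [← ht, h0, map_zero] at h1
      exact (smul_eq_zero.1 h1.symm).resolve_left hH
  · refine iSupIndep_of_projections
      (fun χ => (Fintype.card π.ker : F)⁻¹ • isotypic c χ) (fun χ x hx => ?_) ?_
    · rw [LinearMap.smul_apply, hJe χ x hx, smul_smul, inv_mul_cancel₀ hH, one_smul]
    · rintro χ ψ hne _ ⟨x, rfl⟩
      rw [LinearMap.smul_apply, hc.isotypic_isotypic_of_ne (Ne.symm hne), smul_zero]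
  · rw [eq_top_iff]
    intro x _
    have h1 : x = (Fintype.card π.ker : F)⁻¹ • ∑ χ : π.ker →* Fˣ, isotypic c χ x := by
      rw [hc.sum_isotypic hH, smul_smul, inv_mul_cancel₀ hH, one_smul]
    rw [h1]
    exact Submodule.smul_mem _ _ (Submodule.sum_mem _ fun χ _ =>
      Submodule.mem_iSup_of_mem (p := fun χ => (J χ).toSubmodule) χ ⟨x, rfl⟩)

theorem IsLoopMap.isSemisimpleAlg_iff [IsAlgClosed F] (hq : IsLoopMap π q)
    (hπ : Function.Surjective π) (hA : IsSimpleAlg F A) [Finite π.ker] :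
    IsSemisimpleAlg F B ↔ ¬ ringChar F ∣ Nat.card π.ker := by
  let _ : Fintype π.ker := Fintype.ofFinite _
  rw [← ringChar.spec, Nat.card_eq_fintype_card]
  refine ⟨fun hB h0 => ?_, fun h0 => hq.isSemisimpleAlg hπ hA h0⟩
  obtain ⟨c, hc, -⟩ := hq.exists_action
  refine hc.not_isSemisimpleAlg ?_ h0 hB
  obtain ⟨a, b, hab⟩ := hA.1
  obtain ⟨x, hx⟩ := hq.surjective hπ (a * b)
  refine ⟨x, ?_⟩
  rintro rfl
  exact hab (by rw [← hx, map_zero])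

end GrAlg

/-! ### The centroid, central simple algebras, quotients by ideals -/

section Centroid

variable {F A : Type*} [Field F] [NonUnitalNonAssocRing A] [Module F A] [SMulCommClass F A A]
  [IsScalarTower F A A]

theorem mem_centroid_iff {c : Module.End F A} : c ∈ centroid F A ↔ IsCentroidal c := by
  constructor
  · intro hc x y
    have h := Subalgebra.mem_centralizer_iff F |>.1 hc
    constructor
    · exact (LinearMap.congr_fun (h _ (Algebra.subset_adjoin (Or.inr ⟨y, rfl⟩))) x).symm
    · exact (LinearMap.congr_fun (h _ (Algebra.subset_adjoin (Or.inl ⟨x, rfl⟩))) y).symm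
  · intro hc
    refine (Subalgebra.mem_centralizer_iff F).2 fun m hm => ?_
    refine Algebra.adjoin_induction (p := fun m _ => m * c = c * m) ?_ ?_ ?_ ?_ hm
    · rintro _ (⟨a, rfl⟩ | ⟨a, rfl⟩)
      · exact LinearMap.ext fun x => ((hc a x).2).symm
      · exact LinearMap.ext fun x => ((hc x a).1).symm
    · intro r
      exact Algebra.commutes r c
    · intro m m' _ _ h h'
      rw [add_mul, mul_add, h, h']
    · intro m m' _ _ h h'
      rw [mul_assoc, h', ← mul_assoc, h, mul_assoc]

/-- Over an algebraically closed field, finite-dimensional simple algebras are central. -/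
theorem IsSimpleAlg.isCentralSimpleAlg [IsAlgClosed F] [FiniteDimensional F A]
    (h : IsSimpleAlg F A) : IsCentralSimpleAlg F A := by
  refine ⟨h, eq_bot_iff.2 fun c hc => ?_⟩
  rw [mem_centroid_iff] at hc
  obtain ⟨a, b, hab⟩ := h.1
  have : Nontrivial A := ⟨a * b, 0, hab⟩
  obtain ⟨r, hr⟩ := Module.End.exists_eigenvalue c
  -- For an eigenvalue `r` of `c` the kernel of `c - r` is a nonzero ideal, hence everything.
  let d : A →ₗ[F] A := c - r • LinearMap.id
  have hdx : ∀ x, d x = c x - r • x := fun _ => rfl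
  have hd : IsCentroidal d := fun x y => by
    simp only [hdx, sub_mul, mul_sub, smul_mul_assoc, mul_smul_comm]
    exact ⟨by rw [(hc x y).1], by rw [(hc x y).2]⟩
  rcases h.2 _ (isIdeal_ker_of_isCentroidal hd) with h1 | h1
  · obtain ⟨v, hv⟩ := hr.exists_hasEigenvector
    have : v ∈ LinearMap.ker d := by
      rw [LinearMap.mem_ker, hdx, hv.apply_eq_smul, sub_self]
    rw [h1] at this
    exact absurd this hv.2
  · refine Algebra.mem_bot.2 ⟨r, LinearMap.ext fun x => ?_⟩
    have : x ∈ LinearMap.ker d := by rw [h1]; trivial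
    rw [LinearMap.mem_ker, hdx, sub_eq_zero] at this
    rw [this]
    rfl

/-- The residue field at a maximal ideal is a finite extension of `F`, so it embeds into `F`. -/
theorem exists_algHom_of_commute {F : Type*} [Field F] [IsAlgClosed F] {R : Type*} [Ring R]
    [Algebra F R] [FiniteDimensional F R] [Nontrivial R] (hR : ∀ x y : R, x * y = y * x) :
    Nonempty (R →ₐ[F] F) := by
  let _ : CommRing R := { (inferInstance : Ring R) with mul_comm := hR }
  obtain ⟨m, hm⟩ := Ideal.exists_maximal R
  let _ : Field (R ⧸ m) := Ideal.Quotient.field m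
  have : FiniteDimensional F (R ⧸ m) :=
    Module.Finite.of_surjective (Ideal.Quotient.mkₐ F m).toLinearMap Ideal.Quotient.mk_surjective
  exact ⟨(IsAlgClosed.lift : R ⧸ m →ₐ[F] F).comp (Ideal.Quotient.mkₐ F m)⟩

theorem IsIdeal.exists_quotient {F : Type u} {A : Type w} [Field F]
    [NonUnitalNonAssocRing A] [Module F A]
    [SMulCommClass F A A] [IsScalarTower F A A] {I : Submodule F A} (hI : IsIdeal I) :
    ∃ (Q : Type w) (_ : NonUnitalNonAssocRing Q) (_ : Module F Q) (_ : SMulCommClass F Q Q)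
      (_ : IsScalarTower F Q Q) (q : A →ₙₐ[F] Q), Function.Surjective q ∧
      ∀ x, q x = 0 ↔ x ∈ I := by
  let f : A →ₗ[F] A →ₗ[F] A ⧸ I := (LinearMap.mul F A).compr₂ I.mkQ
  have h1 : I ≤ LinearMap.ker f := fun x hx => LinearMap.mem_ker.2 <| LinearMap.ext fun a =>
    (Submodule.Quotient.mk_eq_zero I).2 (hI a x hx).2
  have h2 : I ≤ LinearMap.ker f.flip := fun x hx => LinearMap.mem_ker.2 <| LinearMap.ext fun a =>
    (Submodule.Quotient.mk_eq_zero I).2 (hI a x hx).1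
  let m : A ⧸ I →ₗ[F] A ⧸ I →ₗ[F] A ⧸ I := f.liftQ₂ I I h1 h2
  let ring : NonUnitalNonAssocRing (A ⧸ I) :=
    { (inferInstance : AddCommGroup (A ⧸ I)) with
      mul := fun x y => m x y
      left_distrib := fun x y z => map_add (m x) y z
      right_distrib := fun x y z => LinearMap.map_add₂ m x y z
      zero_mul := fun x => LinearMap.map_zero₂ m x
      mul_zero := fun x => map_zero (m x) }
  refine ⟨A ⧸ I, ring, (inferInstance : Module F (A ⧸ I)), ⟨fun r x y => ?_⟩, ⟨fun r x y => ?_⟩,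
    { toFun := I.mkQ
      map_smul' := fun r x => map_smul I.mkQ r x
      map_zero' := map_zero I.mkQ
      map_add' := map_add I.mkQ
      map_mul' := fun x y => rfl }, I.mkQ_surjective, fun x => Submodule.Quotient.mk_eq_zero I⟩
  · exact (map_smul (m x) r y).symm
  · exact LinearMap.map_smul₂ m r x y

end Centroid

/-! ### The centroid of a graded-simple algebra -/

namespace GrAlg

variable {F : Type*} [Field F] {G : Type*} [CommGroup G] {B : GrAlg F G}

/-- The linear map `c` is homogeneous of degree `h`. -/
def IsHomogeneousMap (h : G) (c : B →ₗ[F] B) : Prop :=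
  ∀ g, ∀ x ∈ B.comp g, c x ∈ B.comp (h * g)

theorem IsHomogeneousMap.proj {h : G} {c : B →ₗ[F] B} (hc : IsHomogeneousMap h c) (g : G) (x : B) :
    B.proj (h * g) (c x) = c (B.proj g x) :=
  proj_comm c (fun g => h * g) (mul_right_injective h) hc g x

theorem IsGradedSimple.exists_homogeneous_mul_ne_zero (hB : B.IsGradedSimple) :
    ∃ g k, ∃ x ∈ B.comp g, ∃ y ∈ B.comp k, x * y ≠ 0 := by
  by_contra! h
  obtain ⟨x, y, hxy⟩ := hB.1
  apply hxy
  obtain ⟨s, hs, -⟩ := B.exists_eq_sum_proj x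
  obtain ⟨t, ht, -⟩ := B.exists_eq_sum_proj y
  rw [hs, ht, Finset.sum_mul_sum]
  exact Finset.sum_eq_zero fun g _ => Finset.sum_eq_zero fun k _ =>
    h g k _ (proj_mem g x) _ (proj_mem k y)

/-- Schur's lemma for homogeneous elements of the centroid. -/
theorem IsGradedSimple.eq_zero_or_bijective_of_isCentroidal (hB : B.IsGradedSimple) {h : G}
    {c : B →ₗ[F] B} (hc : IsCentroidal c) (hh : IsHomogeneousMap h c) :
    c = 0 ∨ Function.Bijective c := by
  have hk : B.IsGradedIdeal (LinearMap.ker c) := by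
    refine isGradedIdeal_iff.2 ⟨isIdeal_ker_of_isCentroidal hc, fun x hx g => ?_⟩
    rw [LinearMap.mem_ker] at hx ⊢
    rw [← hh.proj, hx, map_zero]
  have hr : B.IsGradedIdeal (LinearMap.range c) := by
    refine isGradedIdeal_iff.2 ⟨isIdeal_range_of_isCentroidal hc, ?_⟩
    rintro _ ⟨x, rfl⟩ g
    refine ⟨B.proj (h⁻¹ * g) x, ?_⟩
    rw [← hh.proj, mul_inv_cancel_left]
  rcases hB.2 _ hk with h1 | h1
  · rcases hB.2 _ hr with h2 | h2
    · exact Or.inl (LinearMap.range_eq_bot.1 h2)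
    · exact Or.inr ⟨LinearMap.ker_eq_bot.1 h1, LinearMap.range_eq_top.1 h2⟩
  · exact Or.inl (LinearMap.ker_eq_top.1 h1)

theorem IsGradedSimple.span_mul_eq_top (hB : B.IsGradedSimple) :
    Submodule.span F {z : B | ∃ x y, z = x * y} = ⊤ := by
  have hm : ∀ x y : B, x * y ∈ Submodule.span F {z : B | ∃ x y, z = x * y} := fun x y =>
    Submodule.subset_span ⟨x, y, rfl⟩
  refine (hB.2 _ (isGradedIdeal_iff.2 ⟨fun a x _ => ⟨hm _ _, hm _ _⟩,
    fun x hx g => ?_⟩)).resolve_left ?_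
  · refine Submodule.span_induction (p := fun x _ => B.proj g x ∈ _) ?_ ?_ ?_ ?_ hx
    · rintro _ ⟨x, y, rfl⟩
      obtain ⟨s, hs, -⟩ := B.exists_eq_sum_proj x
      rw [hs, Finset.sum_mul, map_sum]
      refine Submodule.sum_mem _ fun k _ => ?_
      have := proj_mul_left (proj_mem k x) (k⁻¹ * g) y
      rw [mul_inv_cancel_left] at this
      rw [this]
      exact hm _ _
    · rw [map_zero]; exact zero_mem _
    · intro x y _ _ hx hy
      rw [map_add]; exact add_mem hx hy
    · intro r x _ hx
      rw [map_smul]; exact Submodule.smul_mem _ r hx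
  · intro h0
    obtain ⟨x, y, hxy⟩ := hB.1
    have := hm x y
    rw [h0] at this
    exact hxy this

/-- On products `c (d (x * y)) = c x * d y = d (c (x * y))`, and products span `B`. -/
theorem IsGradedSimple.commute_of_isCentroidal (hB : B.IsGradedSimple) {c d : B →ₗ[F] B}
    (hc : IsCentroidal c) (hd : IsCentroidal d) (x : B) : c (d x) = d (c x) := by
  have hx : x ∈ Submodule.span F {z : B | ∃ x y, z = x * y} := by
    rw [hB.span_mul_eq_top]; trivial
  refine Submodule.span_induction (p := fun x _ => c (d x) = d (c x)) ?_ (by simp) ?_ ?_ hx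
  · rintro _ ⟨x, y, rfl⟩
    rw [(hd x y).2, (hc x _).1, (hc x y).1, (hd _ y).2]
  · intro x y _ _ hx hy
    simp only [map_add, hx, hy]
  · intro r x _ hx
    simp only [map_smul, hx]

/-- The inverse of a bijective element of the centroid. -/
theorem exists_inverse {h : G} {c : B →ₗ[F] B} (hc : IsCentroidal c) (hh : IsHomogeneousMap h c)
    (hb : Function.Bijective c) : ∃ d : B →ₗ[F] B, IsCentroidal d ∧ IsHomogeneousMap h⁻¹ d ∧
      ∀ x, c (d x) = x := by
  let e := LinearEquiv.ofBijective c hb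
  have he : ∀ x, c (e.symm x) = x := e.apply_symm_apply
  refine ⟨e.symm.toLinearMap, fun x y => ⟨hb.1 ?_, hb.1 ?_⟩, fun g x hx => ?_, he⟩
  · refine (he _).trans ?_
    rw [(hc _ _).1]
    exact congrArg (· * y) (he x).symm
  · refine (he _).trans ?_
    rw [(hc _ _).2]
    exact congrArg (x * ·) (he y).symm
  · have h1 : e.symm x = B.proj (h⁻¹ * g) (e.symm x) := by
      apply hb.1
      rw [← hh.proj, he, mul_inv_cancel_left, proj_of_mem hx]
    change e.symm x ∈ _
    rw [h1]
    exact proj_mem _ _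

/-- The support of the centroid of a graded-simple algebra acts by elements of the centroid. -/
theorem IsGradedSimple.exists_centroidAction [IsAlgClosed F] [FiniteDimensional F B]
    (hB : B.IsGradedSimple) : ∃ (H : Subgroup G) (c : H → B →ₗ[F] B), Finite H ∧
      IsCentroidAction H c ∧
      ∀ (h : G) (d : B →ₗ[F] B), IsCentroidal d → IsHomogeneousMap h d → d ≠ 0 → h ∈ H := by
  obtain ⟨k₀, l₀, x₀, hx₀, y₀, hy₀, hxy₀⟩ := hB.exists_homogeneous_mul_ne_zero
  have hx₀0 : x₀ ≠ 0 := by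
    rintro rfl
    exact hxy₀ (zero_mul _)
  have : Nontrivial B := ⟨x₀, 0, hx₀0⟩
  have hid : IsCentroidal (1 : Module.End F B) := fun x y => ⟨rfl, rfl⟩
  have hmulc : ∀ {c d : Module.End F B}, IsCentroidal c → IsCentroidal d → IsCentroidal (c * d) := by
    intro c d hc hd x y
    simp only [Module.End.mul_apply]
    exact ⟨by rw [(hd x y).1, (hc _ _).1], by rw [(hd x y).2, (hc _ _).2]⟩
  have hmulh : ∀ {h k : G} {c d : Module.End F B}, IsHomogeneousMap h c → IsHomogeneousMap k d →
      IsHomogeneousMap (h * k) (c * d) := by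
    intro h k c d hc hd g x hx
    rw [mul_assoc]
    exact hc _ _ (hd _ _ hx)
  have hne : ∀ {h : G} {c : Module.End F B}, IsCentroidal c → IsHomogeneousMap h c → c ≠ 0 →
      Function.Bijective c := fun hc hh h0 =>
    (hB.eq_zero_or_bijective_of_isCentroidal hc hh).resolve_left h0
  have hbne : ∀ {c : Module.End F B}, Function.Bijective c → c ≠ 0 := by
    rintro c hc rfl
    exact hx₀0 (hc.1 rfl)
  let H : Subgroup G :=
    { carrier := {h | ∃ c : Module.End F B, IsCentroidal c ∧ IsHomogeneousMap h c ∧ c ≠ 0}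
      one_mem' := ⟨1, hid, fun g x hx => by rwa [one_mul], one_ne_zero⟩
      mul_mem' := by
        rintro h k ⟨c, hc, hh, hc0⟩ ⟨d, hd, hk, hd0⟩
        exact ⟨c * d, hmulc hc hd, hmulh hh hk, hbne ((hne hc hh hc0).comp (hne hd hk hd0))⟩
      inv_mem' := by
        rintro h ⟨c, hc, hh, hc0⟩
        obtain ⟨d, hd, hdh, hcd⟩ := exists_inverse hc hh (hne hc hh hc0)
        refine ⟨d, hd, hdh, ?_⟩
        rintro rfl
        exact hx₀0 ((hcd x₀).symm.trans (map_zero c)) }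
  have hcomm : ∀ x y : centroid F B, x * y = y * x := fun x y => Subtype.ext <|
    LinearMap.ext fun z => hB.commute_of_isCentroidal (mem_centroid_iff.1 x.2)
      (mem_centroid_iff.1 y.2) z
  -- The choice of a nonzero centroid element in each degree is multiplicative only up to scalars.
  -- The normalisation `ρ = 1` fixes these: `ρ` does not vanish on a nonzero homogeneous element,
  -- which is invertible, so the normalised element of each degree is unique.
  obtain ⟨ρ⟩ := exists_algHom_of_commute (F := F) hcomm
  have hρ0 : ∀ (h : G) (c : centroid F B), IsHomogeneousMap h c.1 → ρ c = 0 → c.1 = 0 := by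
    intro h c hh h0
    by_contra hc0
    have hc := mem_centroid_iff.1 c.2
    obtain ⟨d, hd, -, hcd⟩ := exists_inverse hc hh (hne hc hh hc0)
    have h1 : c * ⟨d, mem_centroid_iff.2 hd⟩ = 1 := Subtype.ext (LinearMap.ext hcd)
    have h2 := congrArg ρ h1
    rw [map_mul, h0, zero_mul, map_one] at h2
    exact zero_ne_one h2
  have hex : ∀ h : H, ∃ c : centroid F B, IsHomogeneousMap h.1 c.1 ∧ ρ c = 1 := by
    rintro ⟨h, c, hc, hh, hc0⟩
    let c' : centroid F B := ⟨c, mem_centroid_iff.2 hc⟩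
    have hρ : ρ c' ≠ 0 := fun h0 => hc0 (hρ0 h c' hh h0)
    refine ⟨(ρ c')⁻¹ • c', fun g x hx => Submodule.smul_mem _ _ (hh g x hx), ?_⟩
    rw [map_smul, smul_eq_mul, inv_mul_cancel₀ hρ]
  choose c hch hρc using hex
  have huniq : ∀ (h : H) (d : centroid F B), IsHomogeneousMap h.1 d.1 → ρ d = 1 → c h = d := by
    intro h d hd hρd
    refine Subtype.ext (sub_eq_zero.1 ?_)
    refine hρ0 h (c h - d) (fun g x hx => sub_mem (hch h g x hx) (hd g x hx)) ?_
    rw [map_sub, hρc, hρd, sub_self]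
  have hc1 : c 1 = 1 := huniq 1 1 (fun g x hx => by rwa [OneMemClass.coe_one, one_mul]) (map_one ρ)
  have hcmul : ∀ h k, c (h * k) = c h * c k := fun h k => huniq _ _ (hmulh (hch h) (hch k))
    (by rw [map_mul, hρc, hρc, one_mul])
  refine ⟨H, fun h => (c h).1, ?_, ⟨hch, fun x => ?_, fun h k x => ?_, fun h =>
    mem_centroid_iff.1 (c h).2⟩, fun h d hd hh hd0 => ⟨d, hd, hh, hd0⟩⟩
  · have hfin : {g | B.comp g ≠ ⊥}.Finite :=
      WellFoundedGT.finite_ne_bot_of_iSupIndep B.iSupIndep_comp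
    have : Finite {g | B.comp g ≠ ⊥} := hfin
    refine Finite.of_injective (β := {g | B.comp g ≠ ⊥}) (fun h => ⟨h * k₀, fun hbot => ?_⟩)
      fun h k e => Subtype.ext (mul_right_cancel (congrArg Subtype.val e))
    have h1 : (c h).1 x₀ ∈ B.comp (h * k₀) := hch h k₀ x₀ hx₀
    rw [hbot] at h1
    have h2 : c h⁻¹ * c h = 1 := by rw [← hcmul, inv_mul_cancel, hc1]
    have h3 : (c h⁻¹).1 ((c h).1 x₀) = x₀ :=
      LinearMap.congr_fun (congrArg Subtype.val h2) x₀
    rw [show (c h).1 x₀ = 0 from h1, map_zero] at h3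
    exact hx₀0 h3.symm
  · rw [hc1]; rfl
  · rw [hcmul]; rfl

end GrAlg

/-! ### Construction and simplicity of the quotient `A` -/

namespace GrAlg

/-- The quotient of `B` by the elements of trace zero is graded by `G ⧸ H`. -/
theorem IsCentroidAction.exists_isLoopMap {F : Type u} [Field F] {G : Type v}
    [CommGroup G] {B : GrAlg.{w} F G} {H : Subgroup G} [Finite H] {c : H → B →ₗ[F] B}
    (hc : IsCentroidAction H c) :
    ∃ (A : GrAlg.{w} F (G ⧸ H)) (q : B →ₙₐ[F] A), IsLoopMap (QuotientGroup.mk' H) q := by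
  classical
  let _ : Fintype H := Fintype.ofFinite H
  let π := QuotientGroup.mk' H
  have hπH : ∀ (h : H) (g : G), π (h * g) = π g := fun h g => by
    rw [map_mul, show π h = 1 from (QuotientGroup.eq_one_iff h.1).2 h.2, one_mul]
  -- The quotient by the kernel of the trace identifies `x` with every `c h x` and is still
  -- injective on each `B_g`. No division by `|H|` occurs, so the characteristic is immaterial.
  let T := isotypic c 1
  have hTc : ∀ h x, T (c h x) = T x := fun h x => by
    have := hc.isotypic_action 1 h x
    rwa [MonoidHom.one_apply, Units.val_one, one_smul] at this
  obtain ⟨Q, iQ1, iQ2, iQ3, iQ4, q, hqs, hqT⟩ :=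
    (isIdeal_ker_of_isCentroidal (hc.isCentroidal_isotypic 1)).exists_quotient
  have hqT : ∀ x, q x = 0 ↔ T x = 0 := fun x => hqT x
  have hqc : ∀ h x, q (c h x) = q x := fun h x => by
    rw [← sub_eq_zero, ← map_sub, hqT, map_sub, hTc, sub_self]
  have hmap : ∀ g k, π g = π k →
      (B.comp g).map (q : B →ₗ[F] Q) ≤ (B.comp k).map (q : B →ₗ[F] Q) := by
    rintro g k hgk _ ⟨x, hx, rfl⟩
    let h : H := ⟨k * g⁻¹, (QuotientGroup.eq_one_iff _).1 (show π (k * g⁻¹) = 1 by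
      rw [map_mul, map_inv, hgk, mul_inv_cancel])⟩
    refine ⟨c h x, ?_, hqc h x⟩
    have := hc.mem h g x hx
    rwa [show (h : G) * g = k from inv_mul_cancel_right k g] at this
  -- The projection onto the degrees in the coset `k`. It commutes with `T`, so it descends to the
  -- quotient as `R k`, and these maps show that the components of `Q` are independent.
  let P : G ⧸ H → B →ₗ[F] B := fun k => B.lift fun g => if π g = k then (B.comp g).subtype else 0
  have hP : ∀ k g, ∀ x ∈ B.comp g, P k x = if π g = k then x else 0 := by
    intro k g x hx
    refine (B.lift_of_mem _ hx).trans ?_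
    split_ifs <;> rfl
  have hTP : ∀ k x, T (P k x) = P k (T x) := by
    intro k x
    refine congrArg (fun f : B →ₗ[F] B => f x)
      (linearMap_ext (f := T ∘ₗ P k) (f' := P k ∘ₗ T) fun g x hx => ?_)
    simp only [LinearMap.comp_apply, T, isotypic_apply, map_sum, map_smul, hP k g x hx,
      fun h => hP k _ _ (hc.mem h g x hx), hπH]
    split_ifs <;> simp
  obtain ⟨s, hs⟩ := LinearMap.exists_rightInverse_of_surjective (q : B →ₗ[F] Q)
    (LinearMap.range_eq_top.2 hqs)
  have hs : ∀ a, q (s a) = a := LinearMap.congr_fun hs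
  let R : G ⧸ H → Q →ₗ[F] Q := fun k => (q : B →ₗ[F] Q) ∘ₗ P k ∘ₗ s
  have hR : ∀ k x, R k (q x) = q (P k x) := by
    intro k x
    change q (P k (s (q x))) = q (P k x)
    rw [← sub_eq_zero, ← map_sub, ← map_sub, hqT, hTP, (hqT _).1, map_zero]
    rw [map_sub, hs, sub_self]
  have hout : ∀ k : G ⧸ H, π k.out = k := fun k => QuotientGroup.out_eq' k
  let N : G ⧸ H → Submodule F Q := fun k => (B.comp k.out).map (q : B →ₗ[F] Q)
  have hN : ∀ g, (B.comp g).map (q : B →ₗ[F] Q) = N (π g) := fun g =>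
    le_antisymm (hmap _ _ (hout _).symm) (hmap _ _ (hout _))
  let A : GrAlg F (G ⧸ H) :=
    { carrier := Q
      comp := N
      iSupIndep_comp := by
        refine iSupIndep_of_projections R ?_ ?_
        · rintro k _ ⟨x, hx, rfl⟩
          refine (hR k x).trans ?_
          rw [hP k _ x hx, if_pos (hout k)]
          rfl
        · rintro k l hlk _ ⟨x, hx, rfl⟩
          refine (hR k x).trans ?_
          rw [hP k _ x hx, hout, if_neg hlk, map_zero]
      iSup_comp := by
        rw [eq_top_iff]
        intro a _
        obtain ⟨x, rfl⟩ := hqs a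
        refine hom_induction (p := fun x => q x ∈ ⨆ k, N k) (fun g x hx => ?_) ?_ ?_ x
        · exact Submodule.mem_iSup_of_mem (π g) (hN g ▸ ⟨x, hx, rfl⟩)
        · rw [map_zero]; exact zero_mem _
        · intro x y hx hy
          rw [map_add]; exact add_mem hx hy
      mul_mem := by
        rintro k l _ _ ⟨x, hx, rfl⟩ ⟨y, hy, rfl⟩
        have h1 := hN (k.out * l.out)
        rw [map_mul, hout, hout] at h1
        rw [← h1]
        exact ⟨x * y, B.mul_mem hx hy, map_mul q x y⟩ }
  exact ⟨A, q, fun g x hx h0 => hc.isotypic_injOn 1 hx ((hqT x).1 h0), hN⟩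

variable {F : Type*} [Field F] {G : Type*} [CommGroup G] {B : GrAlg F G}
  {G' : Type*} [CommGroup G'] {A : GrAlg F G'} {π : G →* G'} {q : B →ₙₐ[F] A}

theorem finite_support (a : A) : {k | A.proj k a ≠ 0}.Finite := by
  obtain ⟨s, -, hs⟩ := A.exists_eq_sum_proj a
  exact s.finite_toSet.subset fun k hk => by
    by_contra h
    exact hk (hs k h)

/-- A partial homogeneous map compatible with multiplications, given by a relation between
homogeneous elements, extends to a homogeneous element of the centroid. -/
theorem IsGradedSimple.exists_isCentroidal_of_relation (hB : B.IsGradedSimple) (d : G)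
    (R : G → B → B → Prop)
    (hmem : ∀ {g x y}, R g x y → x ∈ B.comp g ∧ y ∈ B.comp (g * d))
    (hzero : ∀ g, R g 0 0)
    (hadd : ∀ {g x y x' y'}, R g x y → R g x' y' → R g (x + x') (y + y'))
    (hsmul : ∀ (r : F) {g x y}, R g x y → R g (r • x) (r • y))
    (hleft : ∀ {k u g x y}, u ∈ B.comp k → R g x y → R (k * g) (u * x) (u * y))
    (hright : ∀ {k u g x y}, u ∈ B.comp k → R g x y → R (k * g) (x * u) (y * u))
    (huniq : ∀ {g y}, R g 0 y → y = 0)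
    {g₁ : G} {b₁ b₂ : B} (hb : R g₁ b₁ b₂) (hb₁ : b₁ ≠ 0) :
    ∃ f : B →ₗ[F] B, IsCentroidal f ∧ IsHomogeneousMap d f ∧ f b₁ = b₂ := by
  -- The elements all of whose components lie in the domain of the relation form a graded ideal
  -- containing `b₁ ≠ 0`, hence are all of `B`.
  let D : Submodule F B :=
    { carrier := {x | ∀ g, ∃ y, R g (B.proj g x) y}
      zero_mem' := fun g => ⟨0, by rw [map_zero]; exact hzero g⟩
      add_mem' := fun {x x'} hx hx' g => by
        obtain ⟨y, hy⟩ := hx g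
        obtain ⟨y', hy'⟩ := hx' g
        exact ⟨y + y', by rw [map_add]; exact hadd hy hy'⟩
      smul_mem' := fun r x hx g => by
        obtain ⟨y, hy⟩ := hx g
        exact ⟨r • y, by rw [map_smul]; exact hsmul r hy⟩ }
  have hDmem : ∀ {g x y}, R g x y → x ∈ D := by
    intro g x y h k
    by_cases hk : g = k
    · subst hk
      exact ⟨y, by rwa [proj_of_mem (hmem h).1]⟩
    · exact ⟨0, by rw [proj_of_mem_ne (hmem h).1 hk]; exact hzero k⟩
  have hD : B.IsGradedIdeal D := by
    have hproj : ∀ x ∈ D, ∀ g, B.proj g x ∈ D := fun x hx g => by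
      obtain ⟨y, hy⟩ := hx g
      exact hDmem hy
    refine isGradedIdeal_iff.2 ⟨isIdeal_of_homogeneous (fun g k u hu x hx => ?_) hproj, hproj⟩
    obtain ⟨y, hy⟩ := hx.1 k
    rw [proj_of_mem hx.2] at hy
    exact ⟨hDmem (hleft hu hy), hDmem (hright hu hy)⟩
  have htop : D = ⊤ := (hB.2 D hD).resolve_left fun h0 => by
    have := hDmem hb
    rw [h0] at this
    exact hb₁ this
  have hex : ∀ g, ∀ x : B.comp g, ∃ y, R g x y := fun g x => by
    have hx : (x : B) ∈ D := by rw [htop]; trivial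
    obtain ⟨y, hy⟩ := hx g
    exact ⟨y, by rwa [proj_of_mem x.2] at hy⟩
  have huniq' : ∀ {g x y y'}, R g x y → R g x y' → y = y' := by
    intro g x y y' h h'
    have h1 := hadd h (hsmul (-1) h')
    rw [neg_one_smul, neg_one_smul, add_neg_cancel, ← sub_eq_add_neg] at h1
    exact sub_eq_zero.1 (huniq h1)
  choose φ hφ using hex
  let f : B →ₗ[F] B := B.lift fun g =>
    { toFun := φ g
      map_add' := fun x y => huniq' (hφ g (x + y)) (hadd (hφ g x) (hφ g y))
      map_smul' := fun r x => huniq' (hφ g (r • x)) (hsmul r (hφ g x)) }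
  have hf : ∀ g, ∀ x ∈ B.comp g, R g x (f x) := fun g x hx => by
    have h1 : f x = φ g ⟨x, hx⟩ := B.lift_of_mem _ hx
    rw [h1]
    exact hφ g ⟨x, hx⟩
  refine ⟨f, isCentroidal_of_homogeneous fun g k x hx y hy => ⟨?_, ?_⟩, fun g x hx => ?_, ?_⟩
  · refine huniq' (hf _ _ (B.mul_mem hx hy)) ?_
    rw [mul_comm g k]
    exact hright hy (hf g x hx)
  · exact huniq' (hf _ _ (B.mul_mem hx hy)) (hleft hx (hf k y hy))
  · rw [mul_comm]
    exact (hmem (hf g x hx)).2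
  · exact huniq' (hf g₁ b₁ (hmem hb).1) hb

/-- If `π` kills the support of the centroid of `B`, then the image of a loop map along `π` is
simple. -/
theorem IsLoopMap.isSimpleAlg (hq : IsLoopMap π q) (hπ : Function.Surjective π)
    (hB : B.IsGradedSimple)
    (hcent : ∀ (h : G) (d : B →ₗ[F] B), IsCentroidal d → IsHomogeneousMap h d → d ≠ 0 → π h = 1) :
    IsSimpleAlg F A := by
  refine ⟨?_, fun J hJ => ?_⟩
  · obtain ⟨g, k, x, hx, y, hy, hxy⟩ := hB.exists_homogeneous_mul_ne_zero
    exact ⟨q x, q y, fun h => hxy (hq.injOn _ _ (B.mul_mem hx hy) (by rw [map_mul, h]))⟩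
  rw [or_iff_not_imp_left]
  intro hJ0
  have hlift : ∀ g, ∀ a ∈ A.comp (π g), ∃ x ∈ B.comp g, q x = a := by
    intro g a ha
    rw [← hq.map_comp g] at ha
    exact ha
  obtain ⟨a₀, ha₀, ha₀0⟩ := (Submodule.ne_bot_iff J).1 hJ0
  -- `J` need not be graded. A nonzero element of `J` with the fewest homogeneous components is
  -- chosen, and it will turn out to be homogeneous.
  obtain ⟨a, ⟨haJ, ha0⟩, hmin⟩ := WellFounded.has_min
    (measure fun a : A => {k | A.proj k a ≠ 0}.ncard).wf {a | a ∈ J ∧ a ≠ 0} ⟨a₀, ha₀, ha₀0⟩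
  have hmin : ∀ z ∈ J, ∀ t k₁ : G', A.proj k₁ a ≠ 0 → (∀ k, A.proj k a = 0 → A.proj (t * k) z = 0) →
      A.proj (t * k₁) z = 0 → z = 0 := by
    intro z hz t k₁ hk₁ hsupp h1
    by_contra hz0
    refine hmin z ⟨hz, hz0⟩ ?_
    change {k | A.proj k z ≠ 0}.ncard < {k | A.proj k a ≠ 0}.ncard
    have hsub : {k | A.proj k z ≠ 0} ⊆ (t * ·) '' ({k | A.proj k a ≠ 0} \ {k₁}) := by
      intro k hk
      refine ⟨t⁻¹ * k, ⟨fun h => hk ?_, fun h => hk ?_⟩, mul_inv_cancel_left t k⟩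
      · have := hsupp _ h
        rwa [mul_inv_cancel_left] at this
      · rw [Set.mem_singleton_iff] at h
        rwa [← h, mul_inv_cancel_left] at h1
    have hfin := (finite_support a).sdiff (t := {k₁})
    calc {k | A.proj k z ≠ 0}.ncard ≤ _ := Set.ncard_le_ncard hsub (hfin.image _)
      _ ≤ ({k | A.proj k a ≠ 0} \ {k₁}).ncard := Set.ncard_image_le hfin
      _ < _ := Set.ncard_sdiff_singleton_lt_of_mem hk₁ (finite_support a)
  have hhom : ∀ k₁ k₂, A.proj k₁ a ≠ 0 → A.proj k₂ a ≠ 0 → k₁ = k₂ := by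
    intro k₁ k₂ h1 h2
    obtain ⟨g₁, rfl⟩ := hπ k₁
    obtain ⟨g₂, rfl⟩ := hπ k₂
    obtain ⟨b₁, hb₁, hqb₁⟩ := hlift g₁ _ (proj_mem _ a)
    obtain ⟨b₂, hb₂, hqb₂⟩ := hlift g₂ _ (proj_mem _ a)
    have hb₁0 : b₁ ≠ 0 := by
      rintro rfl
      exact h1 (by rw [← hqb₁, map_zero])
    have hb₂0 : b₂ ≠ 0 := by
      rintro rfl
      exact h2 (by rw [← hqb₂, map_zero])
    let d := g₁⁻¹ * g₂
    let t : G → G' := fun g => π (g * g₁⁻¹)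
    have ht : ∀ k g, t (k * g) = π k * t g := fun k g => by simp [t, mul_assoc]
    have ht1 : ∀ g, t g * π g₁ = π g := fun g => by simp [t]
    -- Relates the components at the translates of `π g₁` and `π g₂` of those `z ∈ J` that are
    -- supported in a translate of the support of `a`. By minimality `z = 0` once the first
    -- component vanishes, so the relation is a partial function. It yields a centroid element of
    -- degree `d` taking `b₁` to `b₂ ≠ 0`, whence `π d = 1`.
    let R : G → B → B → Prop := fun g x y => x ∈ B.comp g ∧ y ∈ B.comp (g * d) ∧
      ∃ z ∈ J, (∀ k, A.proj k a = 0 → A.proj (t g * k) z = 0) ∧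
        A.proj (t g * π g₁) z = q x ∧ A.proj (t g * π g₂) z = q y
    obtain ⟨f, hf, hfd, hfb⟩ := hB.exists_isCentroidal_of_relation d R (g₁ := g₁) (b₁ := b₁)
      (b₂ := b₂) (fun h => ⟨h.1, h.2.1⟩)
      (fun g => ⟨zero_mem _, zero_mem _, 0, zero_mem _, by simp⟩)
      (by
        rintro g x y x' y' ⟨hx, hy, z, hz, e1, e2, e3⟩ ⟨hx', hy', z', hz', e1', e2', e3'⟩
        refine ⟨add_mem hx hx', add_mem hy hy', z + z', add_mem hz hz', fun k hk => ?_, ?_, ?_⟩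
        · rw [map_add, e1 k hk, e1' k hk, add_zero]
        · rw [map_add, map_add, e2, e2']
        · rw [map_add, map_add, e3, e3'])
      (by
        rintro r g x y ⟨hx, hy, z, hz, e1, e2, e3⟩
        refine ⟨Submodule.smul_mem _ r hx, Submodule.smul_mem _ r hy, r • z,
          Submodule.smul_mem _ r hz, fun k hk => ?_, ?_, ?_⟩
        · rw [map_smul, e1 k hk, smul_zero]
        · rw [map_smul, map_smul, e2]
        · rw [map_smul, map_smul, e3])
      (by
        rintro k u g x y hu ⟨hx, hy, z, hz, e1, e2, e3⟩
        have hqu := hq.mem hu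
        refine ⟨B.mul_mem hu hx, by rw [mul_assoc]; exact B.mul_mem hu hy, q u * z,
          (hJ _ z hz).1, fun l hl => ?_, ?_, ?_⟩
        · rw [ht, mul_assoc, proj_mul_left hqu, e1 l hl, mul_zero]
        · rw [ht, mul_assoc, proj_mul_left hqu, e2, map_mul]
        · rw [ht, mul_assoc, proj_mul_left hqu, e3, map_mul])
      (by
        rintro k u g x y hu ⟨hx, hy, z, hz, e1, e2, e3⟩
        have hqu := hq.mem hu
        refine ⟨by rw [mul_comm]; exact B.mul_mem hx hu,
          by rw [mul_assoc, mul_comm]; exact B.mul_mem hy hu, z * q u,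
          (hJ _ z hz).2, fun l hl => ?_, ?_, ?_⟩
        · rw [ht, mul_assoc, proj_mul_right hqu, e1 l hl, zero_mul]
        · rw [ht, mul_assoc, proj_mul_right hqu, e2, map_mul]
        · rw [ht, mul_assoc, proj_mul_right hqu, e3, map_mul])
      (by
        rintro g y ⟨-, hy, z, hz, e1, e2, e3⟩
        rw [map_zero] at e2
        refine hq.injOn _ y hy ?_
        rw [← e3, hmin z hz _ _ h1 e1 e2, map_zero])
      (by
        refine ⟨hb₁, by rwa [mul_inv_cancel_left], a, haJ, ?_⟩
        have ht0 : t g₁ = 1 := by simp [t]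
        simp only [ht0, one_mul]
        exact ⟨fun k hk => hk, hqb₁.symm, hqb₂.symm⟩) hb₁0
    have h3 := hcent d f hf hfd fun h0 => hb₂0 (by rw [← hfb, h0, LinearMap.zero_apply])
    rw [map_mul, map_inv] at h3
    exact inv_mul_eq_one.1 h3
  obtain ⟨k, hk⟩ : ∃ k, A.proj k a ≠ 0 := by
    by_contra! h
    exact ha0 (eq_zero_of_proj h)
  have hak : A.proj k a = a := by
    refine (sub_eq_zero.1 (eq_zero_of_proj fun l => ?_)).symm
    rw [map_sub, sub_eq_zero]
    by_cases hl : k = l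
    · subst hl
      rw [proj_of_mem (proj_mem k a)]
    · rw [proj_of_mem_ne (proj_mem k a) hl]
      by_contra h
      exact hl (hhom _ _ hk h)
  obtain ⟨g, rfl⟩ := hπ k
  obtain ⟨b, hb, hqb⟩ := hlift g _ (proj_mem _ a)
  rw [hak] at hqb
  -- The pullback of `J`, taken component by component, is a graded ideal of `B`. It is nonzero
  -- because it contains the lift `b` of the homogeneous element `a`, so it is `B`, and `J` contains
  -- every component of `A`.
  let I : Submodule F B :=
    { carrier := {x | ∀ g, q (B.proj g x) ∈ J}
      zero_mem' := fun g => by rw [map_zero, map_zero]; exact zero_mem _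
      add_mem' := fun {x y} hx hy g => by
        rw [map_add, map_add]; exact add_mem (hx g) (hy g)
      smul_mem' := fun r x hx g => by
        rw [map_smul, map_smul]; exact Submodule.smul_mem _ r (hx g) }
  have hImem : ∀ {g x}, x ∈ B.comp g → q x ∈ J → x ∈ I := by
    intro g x hx hqx k
    by_cases hk : g = k
    · subst hk
      rwa [proj_of_mem hx]
    · rw [proj_of_mem_ne hx hk, map_zero]
      exact zero_mem _
  have hI : B.IsGradedIdeal I := by
    have hproj : ∀ x ∈ I, ∀ g, B.proj g x ∈ I := fun x hx g => hImem (proj_mem g x) (hx g)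
    refine isGradedIdeal_iff.2 ⟨isIdeal_of_homogeneous (fun g k u hu x hx => ?_) hproj, hproj⟩
    have h1 := hx.1 k
    rw [proj_of_mem hx.2] at h1
    refine ⟨hImem (B.mul_mem hu hx.2) ?_, hImem (B.mul_mem hx.2 hu) ?_⟩
    · rw [map_mul]; exact (hJ _ _ h1).1
    · rw [map_mul]; exact (hJ _ _ h1).2
  have hItop : I = ⊤ := (hB.2 I hI).resolve_left fun h0 => by
    have : b ∈ I := hImem hb (hqb ▸ haJ)
    rw [h0] at this
    have hb0 : b = 0 := this
    exact ha0 (by rw [← hqb, hb0, map_zero])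
  rw [eq_top_iff, ← A.iSup_comp]
  refine iSup_le fun k => ?_
  obtain ⟨g, rfl⟩ := hπ k
  intro y hy
  obtain ⟨x, hx, rfl⟩ := hlift g y hy
  have h1 : x ∈ I := by rw [hItop]; trivial
  have h2 := h1 g
  rwa [proj_of_mem hx] at h2

/-- Finite-dimensional graded-simple algebras are loop algebras of central simple algebras. -/
theorem IsGradedSimple.exists_isomorphic_loop {F : Type u} [Field F] [IsAlgClosed F]
    {G : Type v} [CommGroup G] {B : GrAlg.{w} F G} [FiniteDimensional F B]
    (hB : B.IsGradedSimple) :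
    ∃ (G' : Type v) (_ : CommGroup G') (π : G →* G') (A : GrAlg.{w} F G'),
      Function.Surjective π ∧ Finite π.ker ∧ IsCentralSimpleAlg F A ∧
      B.Isomorphic (loop π A) ∧ ∃ q : B →ₙₐ[F] A, Function.Surjective q := by
  obtain ⟨H, c, hH, hc, hcent⟩ := hB.exists_centroidAction
  obtain ⟨A, q, hq⟩ := hc.exists_isLoopMap
  have hπ : Function.Surjective (QuotientGroup.mk' H) := QuotientGroup.mk'_surjective H
  have hqs := hq.surjective hπ
  have hfd : FiniteDimensional F A := Module.Finite.of_surjective (q : B →ₗ[F] A) hqs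
  have hA : IsSimpleAlg F A := hq.isSimpleAlg hπ hB fun h d hd hh h0 =>
    (QuotientGroup.eq_one_iff h).2 (hcent h d hd hh h0)
  exact ⟨G ⧸ H, inferInstance, QuotientGroup.mk' H, A, hπ,
    by rwa [QuotientGroup.ker_mk'], hA.isCentralSimpleAlg, hq.isomorphic_loop, q, hqs⟩

end GrAlg
end AlgGrading

theorem theorem4 (F : Type u) [Field F] [IsAlgClosed F]
    (G : Type v) [CommGroup G] :
    -- semisimple graded algebras are products of graded-simple ones, in a unique way
    (∀ B : GrAlg.{w} F G, IsSemisimpleAlg F B →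
      ∃ (n : ℕ) (C : Fin n → GrAlg.{w} F G),
        (∀ i, (C i).IsGradedSimple ∧ IsSemisimpleAlg F (C i)) ∧
        B.Isomorphic (GrAlg.prod C) ∧
        ∀ (m : ℕ) (D : Fin m → GrAlg.{w₁} F G),
          (∀ j, (D j).IsGradedSimple ∧ IsSemisimpleAlg F (D j)) →
          B.Isomorphic (GrAlg.prod D) →
          ∃ σ : Fin n ≃ Fin m, ∀ i, (C i).Isomorphic (D (σ i))) ∧
    -- finite-dimensional graded-simple algebras are loop algebras
    (∀ B : GrAlg.{w} F G, FiniteDimensional F B → B.IsGradedSimple →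
      (∃ (G' : Type v) (_ : CommGroup G') (π : G →* G') (A : GrAlg.{w} F G'),
        Function.Surjective π ∧ Finite π.ker ∧ IsCentralSimpleAlg F A ∧
        B.Isomorphic (GrAlg.loop π A) ∧ ∃ q : B →ₙₐ[F] A, Function.Surjective q) ∧
      ∀ (G' : Type v₁) (_ : CommGroup G') (π : G →* G') (A : GrAlg.{w₁} F G'),
        Function.Surjective π → Finite π.ker → IsCentralSimpleAlg F A →
        B.Isomorphic (GrAlg.loop π A) →
        (∃ q : B →ₙₐ[F] A, Function.Surjective q) ∧
        (IsSemisimpleAlg F B ↔ ¬ ringChar F ∣ Nat.card π.ker)) := by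
  refine ⟨fun B hB => ?_, fun B hfd hB => ⟨hB.exists_isomorphic_loop, ?_⟩⟩
  · obtain ⟨n, C, hC, hBC⟩ := GrAlg.exists_isomorphic_prod hB
    exact ⟨n, C, hC, hBC, fun m D hD hBD => GrAlg.Isomorphic.exists_equiv_of_prod
      (fun i => (hC i).1) (fun j => (hD j).1) (hBC.symm.trans hBD)⟩
  · intro G' _ π A hπ _ hA h
    obtain ⟨q, hq⟩ := h.exists_isLoopMap
    exact ⟨⟨q, hq.surjective hπ⟩, hq.isSemisimpleAlg_iff hπ hA.1⟩
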